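/- Let $\mathcal H_1,\mathcal H_2$ be infinite-dimensional separable complex Hilbert spaces with orthonormal bases $(e_{i,1})_{i\in\mathbb N}$ and $(e_{i,2})_{i\in\mathbb N}$, let $\mathcal H=\mathcal H_1\otimes\mathcal H_2$ be their Hilbert space tensor product, and let $\mathcal X\subseteq\mathcal H$ be a finite-dimensional subspace. A density operator is a positive semidefinite trace class operator of trace $1$; let $\rho_1,\rho_2$ be density operators on $\mathcal H_1,\mathcal H_2$. Write $\operatorname{tr}_2$ and $\operatorname{tr}_1$ for the partial traces from trace class operators on $\mathcal H$ to trace class operators on $\mathcal H_1$ and $\mathcal H_2$ respectively, $\operatorname{supp}\rho$ for the closure of the range of a selfadjoint operator $\rho$, and $A\preceq B$ when $B-A$ is positive semidefinite. For $n\in\mathbb N$ and $i\in\{1,2\}$ let $P_{n,i}$ be the orthogonal projection of $\mathcal H_i$ onto the span of the first $n$ basis vectors $e_{1,i},\dots,e_{n,i}$, and put $\rho_{i,n}=P_{n,i}\,\rho_i\,P_{n,i}$ and $\mathcal X_n=(P_{n,1}\otimes P_{n,2})\mathcal X$. Let $P_{\mathcal X_n}$ be the orthogonal projection of $\mathcal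 H$ onto $\mathcal X_n$, and define $$\mu_n(\rho_1,\rho_2,\mathcal X)=\max\bigl\{\operatorname{tr}(XP_{\mathcal X_n}) : X=(P_{n,1}\otimes P_{n,2})\,Y\,(P_{n,1}\otimes P_{n,2}),\ Y\ \text{bounded and positive semidefinite on }\mathcal H,\ \operatorname{tr}_2X\preceq\rho_{1,n},\ \operatorname{tr}_1X\preceq\rho_{2,n}\bigr\}.$$ Then each of these maxima is attained, and the following are equivalent: 1. there is a density operator $\rho$ on $\mathcal H$ with $\operatorname{tr}_1\rho=\rho_2$, $\operatorname{tr}_2\rho=\rho_1$ and $\operatorname{supp}\rho\subseteq\mathcal X$; 2. $\lim_{n\to\infty}\mu_n(\rho_1,\rho_2,\mathcal X)=1$. -/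

import Mathlib

open Filter Topology
open scoped TensorProduct

noncomputable section

namespace QuantumMarginal

/-! ### Trace class operators, trace, density operators -/

section Trace

variable {H : Type*} [NormedAddCommGroup H] [InnerProductSpace ℂ H] [CompleteSpace H]

variable (H) in
/-- The index set (a set of vectors) of a chosen orthonormal Hilbert basis of `H`. -/
def basisSet : Set H := (exists_hilbertBasis ℂ H).choose

variable (H) in
/-- A chosen orthonormal Hilbert basis of `H`. -/
def someBasis : HilbertBasis (basisSet H) ℂ H := (exists_hilbertBasis ℂ H).choose_spec.choose

/-- `A` is trace class: the diagonal of `|A| = (A* A)^{1/2}` in an orthonormal basis is summable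
(whether this holds does not depend on the orthonormal basis). -/
def IsTraceClass (A : H →L[ℂ] H) : Prop :=
  Summable fun i => (inner ℂ (someBasis H i) (CFC.abs A (someBasis H i))).re

/-- The trace `∑ i, ⟨A bᵢ, bᵢ⟩` over an orthonormal basis.  For a trace class operator the series
converges absolutely and its sum does not depend on the orthonormal basis.
(Mathlib's inner product is linear in the second argument.) -/
def trace (A : H →L[ℂ] H) : ℂ := ∑' i, inner ℂ (someBasis H i) (A (someBasis H i))

/-- Density operators: positive semidefinite trace class operators of trace one. Here `≤` is
the Loewner order. -/
structure IsDensityOperator (ρ : H →L[ℂ] H) : Prop where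
  nonneg : 0 ≤ ρ
  traceClass : IsTraceClass ρ
  trace_eq_one : trace ρ = 1

/-- The support of a selfadjoint operator: the closure of its range. -/
def supp (A : H →L[ℂ] H) : Submodule ℂ H :=
  (LinearMap.range (A : H →ₗ[ℂ] H)).topologicalClosure

/-- The span of the first `n` vectors of an orthonormal basis. -/
def truncSpan (e : HilbertBasis ℕ ℂ H) (n : ℕ) : Submodule ℂ H :=
  Submodule.span ℂ (Set.range fun k : Fin n => e k)

instance instFiniteDimensionalTruncSpan (e : HilbertBasis ℕ ℂ H) (n : ℕ) :
    FiniteDimensional ℂ (truncSpan e n) :=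
  FiniteDimensional.span_of_finite ℂ (Set.finite_range _)

/-- The orthogonal projection onto the span of the first `n` vectors of an orthonormal basis. -/
def truncProj (e : HilbertBasis ℕ ℂ H) (n : ℕ) : H →L[ℂ] H :=
  (truncSpan e n).starProjection

end Trace

/-! ### Hilbert space tensor product and partial traces -/

section Tensor

/-- The Hilbert space tensor product: the completion of the algebraic tensor product for the inner
product with `⟨x ⊗ y, u ⊗ v⟩ = ⟨x, u⟩ ⟨y, v⟩`. -/
abbrev HTensor (H₁ H₂ : Type*) [NormedAddCommGroup H₁] [InnerProductSpace ℂ H₁]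
    [NormedAddCommGroup H₂] [InnerProductSpace ℂ H₂] : Type _ :=
  UniformSpace.Completion (H₁ ⊗[ℂ] H₂)

variable {H₁ H₂ : Type*} [NormedAddCommGroup H₁] [InnerProductSpace ℂ H₁]
  [NormedAddCommGroup H₂] [InnerProductSpace ℂ H₂]

/-- The operator `A ⊗ B` on the Hilbert space tensor product. -/
def opTensor (A : H₁ →L[ℂ] H₁) (B : H₂ →L[ℂ] H₂) : HTensor H₁ H₂ →L[ℂ] HTensor H₁ H₂ :=
  (TensorProduct.mapL A B).completion

/-- For `x : H₁`, the operator `H₂ → H₁ ⊗ H₂`, `y ↦ x ⊗ y`. -/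
def tensorLeft (x : H₁) : H₂ →L[ℂ] HTensor H₁ H₂ :=
  UniformSpace.Completion.toComplL ∘L TensorProduct.mkL ℂ H₁ H₂ x

/-- For `y : H₂`, the operator `H₁ → H₁ ⊗ H₂`, `x ↦ x ⊗ y`. -/
def tensorRight (y : H₂) : H₁ →L[ℂ] HTensor H₁ H₂ :=
  UniformSpace.Completion.toComplL ∘L (TensorProduct.mkL ℂ H₁ H₂).flip y

variable [CompleteSpace H₁] [CompleteSpace H₂]

/-- `tr₁ F`, an operator on `H₂`: for an orthonormal basis `bᵢ` of `H₁`,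
`⟨(tr₁ F) u, v⟩ = ∑ i, ⟨F (bᵢ ⊗ u), bᵢ ⊗ v⟩`.  For a trace class operator `F` the series below
converges absolutely in norm, and its sum does not depend on the orthonormal basis. -/
def partialTrace₁ (F : HTensor H₁ H₂ →L[ℂ] HTensor H₁ H₂) : H₂ →L[ℂ] H₂ :=
  ∑' i, (tensorLeft (someBasis H₁ i : H₁)).adjoint ∘L F ∘L tensorLeft (someBasis H₁ i : H₁)

/-- `tr₂ F`, an operator on `H₁`: for an orthonormal basis `bⱼ` of `H₂`,
`⟨(tr₂ F) x, y⟩ = ∑ j, ⟨F (x ⊗ bⱼ), y ⊗ bⱼ⟩`.  For a trace class operator `F` the series below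
converges absolutely in norm, and its sum does not depend on the orthonormal basis. -/
def partialTrace₂ (F : HTensor H₁ H₂ →L[ℂ] HTensor H₁ H₂) : H₁ →L[ℂ] H₁ :=
  ∑' j, (tensorRight (someBasis H₂ j : H₂)).adjoint ∘L F ∘L tensorRight (someBasis H₂ j : H₂)

/-! ### The truncated semidefinite programs -/

variable (e₁ : HilbertBasis ℕ ℂ H₁) (e₂ : HilbertBasis ℕ ℂ H₂)

/-- `P_{n,1} ⊗ P_{n,2}`. -/
def truncTensor (n : ℕ) : HTensor H₁ H₂ →L[ℂ] HTensor H₁ H₂ :=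
  opTensor (truncProj e₁ n) (truncProj e₂ n)

/-- `𝒳ₙ = (P_{n,1} ⊗ P_{n,2}) 𝒳`. -/
def truncSubspace (𝒳 : Submodule ℂ (HTensor H₁ H₂)) (n : ℕ) : Submodule ℂ (HTensor H₁ H₂) :=
  𝒳.map (truncTensor e₁ e₂ n : HTensor H₁ H₂ →ₗ[ℂ] HTensor H₁ H₂)

instance instFiniteDimensionalTruncSubspace (𝒳 : Submodule ℂ (HTensor H₁ H₂)) [FiniteDimensional ℂ 𝒳] (n : ℕ) :
    FiniteDimensional ℂ (truncSubspace e₁ e₂ 𝒳 n) :=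
  inferInstanceAs (FiniteDimensional ℂ
    (𝒳.map (truncTensor e₁ e₂ n : HTensor H₁ H₂ →ₗ[ℂ] HTensor H₁ H₂)))

/-- The feasible operators `X` of the `n`-th program: `X` lies in
`(P_{n,1} ⊗ P_{n,2}) S₊(H) (P_{n,1} ⊗ P_{n,2})`, `tr₂ X ⪯ P_{n,1} ρ₁ P_{n,1}` and
`tr₁ X ⪯ P_{n,2} ρ₂ P_{n,2}`. -/
structure IsFeasible (ρ₁ : H₁ →L[ℂ] H₁) (ρ₂ : H₂ →L[ℂ] H₂) (n : ℕ)
    (X : HTensor H₁ H₂ →L[ℂ] HTensor H₁ H₂) : Prop where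
  compressed : ∃ Y : HTensor H₁ H₂ →L[ℂ] HTensor H₁ H₂, 0 ≤ Y ∧
    X = truncTensor e₁ e₂ n ∘L Y ∘L truncTensor e₁ e₂ n
  partialTrace₂_le : partialTrace₂ X ≤ truncProj e₁ n ∘L ρ₁ ∘L truncProj e₁ n
  partialTrace₁_le : partialTrace₁ X ≤ truncProj e₂ n ∘L ρ₂ ∘L truncProj e₂ n

/-- The (real) values `tr (X P_{𝒳ₙ})` of the objective at the feasible operators. -/
def sdpValues (ρ₁ : H₁ →L[ℂ] H₁) (ρ₂ : H₂ →L[ℂ] H₂) (𝒳 : Submodule ℂ (HTensor H₁ H₂))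
    [FiniteDimensional ℂ 𝒳] (n : ℕ) : Set ℝ :=
  {t | ∃ X, IsFeasible e₁ e₂ ρ₁ ρ₂ n X ∧
    (t : ℂ) = trace (X ∘L (truncSubspace e₁ e₂ 𝒳 n).starProjection)}

/-- `μₙ(ρ₁, ρ₂, 𝒳)`, the optimal value of the `n`-th program. -/
def sdpMax (ρ₁ : H₁ →L[ℂ] H₁) (ρ₂ : H₂ →L[ℂ] H₂) (𝒳 : Submodule ℂ (HTensor H₁ H₂))
    [FiniteDimensional ℂ 𝒳] (n : ℕ) : ℝ :=
  sSup (sdpValues e₁ e₂ ρ₁ ρ₂ 𝒳 n)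

end Tensor

end QuantumMarginal

end

noncomputable section

namespace QuantumMarginal

section PositiveTrace

open scoped ENNReal InnerProduct

variable {ι κ : Type*} {H : Type*} [NormedAddCommGroup H] [InnerProductSpace ℂ H]
  {G : Type*} [NormedAddCommGroup G] [InnerProductSpace ℂ G]

omit [InnerProductSpace ℂ H] in
theorem enorm_sq_eq_ofReal (x : H) : ‖x‖ₑ ^ 2 = ENNReal.ofReal (‖x‖ ^ 2) := by
  rw [← ofReal_norm, ENNReal.ofReal_pow (norm_nonneg _)]

/-- Parseval's identity. -/
theorem tsum_enorm_inner_sq (b : HilbertBasis ι ℂ H) (x : H) :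
    ∑' i, ‖inner ℂ (b i) x‖ₑ ^ 2 = ‖x‖ₑ ^ 2 := by
  have h := b.hasSum_inner_mul_inner x x
  have h2 : HasSum (fun i => ‖inner ℂ (b i) x‖ ^ 2) (‖x‖ ^ 2) := by
    have h3 := Complex.hasSum_re h
    rw [inner_self_eq_norm_sq_to_K] at h3
    convert h3 using 1
    · ext i
      rw [← inner_conj_symm x (b i), mul_comm, RCLike.mul_conj]
      norm_cast
    · norm_cast
  rw [enorm_sq_eq_ofReal x, ← h2.tsum_eq,
    ENNReal.ofReal_tsum_of_nonneg (fun _ => by positivity) h2.summable]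
  exact tsum_congr fun i => enorm_sq_eq_ofReal _

variable [CompleteSpace H] [CompleteSpace G]

/-- The squared Hilbert-Schmidt norms of an operator and of its adjoint agree. -/
theorem tsum_enorm_sq_adjoint (b : HilbertBasis ι ℂ H) (c : HilbertBasis κ ℂ G) (A : H →L[ℂ] G) :
    ∑' i, ‖A (b i)‖ₑ ^ 2 = ∑' j, ‖A.adjoint (c j)‖ₑ ^ 2 := by
  simp_rw [← tsum_enorm_inner_sq c, ← tsum_enorm_inner_sq b]
  rw [ENNReal.tsum_comm]
  refine tsum_congr fun j => tsum_congr fun i => ?_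
  rw [ContinuousLinearMap.adjoint_inner_right, ← inner_conj_symm, ← ofReal_norm,
    ← ofReal_norm, RCLike.norm_conj]

/-- The diagonal sum of an operator along a Hilbert basis, as an extended nonnegative real. -/
def posTrace (b : HilbertBasis ι ℂ H) (X : H →L[ℂ] H) : ℝ≥0∞ :=
  ∑' i, ENNReal.ofReal (inner ℂ (b i) (X (b i))).re

theorem exists_selfAdjoint_sq {X : H →L[ℂ] H} (hX : 0 ≤ X) :
    ∃ S : H →L[ℂ] H, S.adjoint = S ∧ X = S ∘L S := by
  have h : IsSelfAdjoint (CFC.sqrt X) := (CFC.sqrt_nonneg X).isSelfAdjoint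
  exact ⟨CFC.sqrt X, h, (CFC.sqrt_mul_sqrt_self X hX).symm⟩

theorem inner_adjoint_comp_self (A : H →L[ℂ] G) (z : H) :
    inner ℂ z ((A.adjoint ∘L A) z) = ((‖A z‖ ^ 2 : ℝ) : ℂ) := by
  rw [ContinuousLinearMap.comp_apply, ContinuousLinearMap.adjoint_inner_right,
    inner_self_eq_norm_sq_to_K]
  norm_cast

theorem posTrace_adjoint_comp_self (b : HilbertBasis ι ℂ H) (A : H →L[ℂ] G) :
    posTrace b (A.adjoint ∘L A) = ∑' i, ‖A (b i)‖ₑ ^ 2 := by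
  refine tsum_congr fun i => ?_
  rw [inner_adjoint_comp_self, Complex.ofReal_re, enorm_sq_eq_ofReal]

theorem posTrace_eq_posTrace (b : HilbertBasis ι ℂ H) (c : HilbertBasis κ ℂ H) {X : H →L[ℂ] H}
    (hX : 0 ≤ X) : posTrace b X = posTrace c X := by
  obtain ⟨S, hS, rfl⟩ := exists_selfAdjoint_sq hX
  have e : S ∘L S = S.adjoint ∘L S := by rw [hS]
  rw [e, posTrace_adjoint_comp_self, posTrace_adjoint_comp_self, tsum_enorm_sq_adjoint b c, hS]

omit [CompleteSpace H] in
theorem re_inner_nonneg {X : H →L[ℂ] H} (hX : 0 ≤ X) (z : H) : 0 ≤ (inner ℂ z (X z)).re :=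
  ((ContinuousLinearMap.nonneg_iff_isPositive X).1 hX).re_inner_nonneg_right z

theorem ofReal_re_inner {X : H →L[ℂ] H} (hX : 0 ≤ X) (z : H) :
    (((inner ℂ z (X z)).re : ℝ) : ℂ) = inner ℂ z (X z) := by
  obtain ⟨S, hS, rfl⟩ := exists_selfAdjoint_sq hX
  have e : S ∘L S = S.adjoint ∘L S := by rw [hS]
  rw [e, inner_adjoint_comp_self, Complex.ofReal_re]

theorem le_iff_re_inner_le {X Y : H →L[ℂ] H} (hX : IsSelfAdjoint X) (hY : IsSelfAdjoint Y) :
    X ≤ Y ↔ ∀ z, (inner ℂ z (X z)).re ≤ (inner ℂ z (Y z)).re := by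
  rw [ContinuousLinearMap.le_def, ContinuousLinearMap.isPositive_def']
  constructor
  · rintro ⟨-, h⟩ z
    have := h z
    rw [ContinuousLinearMap.reApplyInnerSelf_apply, ← inner_conj_symm, RCLike.conj_re] at this
    simpa [inner_sub_right] using this
  · refine fun h => ⟨hY.sub hX, fun z => ?_⟩
    rw [ContinuousLinearMap.reApplyInnerSelf_apply, ← inner_conj_symm, RCLike.conj_re]
    simpa [inner_sub_right] using h z

theorem nonneg_adjoint_conj {X : H →L[ℂ] H} (hX : 0 ≤ X) (C : G →L[ℂ] H) :
    0 ≤ C.adjoint ∘L X ∘L C := by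
  rw [ContinuousLinearMap.nonneg_iff_isPositive] at hX ⊢
  exact hX.adjoint_conj C

theorem posTrace_conj_le (b : HilbertBasis ι ℂ H) (c : HilbertBasis κ ℂ G) {X : H →L[ℂ] H}
    (hX : 0 ≤ X) {C : G →L[ℂ] H} (hC : ‖C‖ ≤ 1) :
    posTrace c (C.adjoint ∘L X ∘L C) ≤ posTrace b X := by
  obtain ⟨S, hS, rfl⟩ := exists_selfAdjoint_sq hX
  have e : S ∘L S = S.adjoint ∘L S := by rw [hS]
  have e2 : C.adjoint ∘L (S ∘L S) ∘L C = (S ∘L C).adjoint ∘L (S ∘L C) := by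
    rw [ContinuousLinearMap.adjoint_comp, hS]; rfl
  rw [e2, e, posTrace_adjoint_comp_self, posTrace_adjoint_comp_self, tsum_enorm_sq_adjoint c b]
  refine ENNReal.tsum_le_tsum fun i => ?_
  rw [ContinuousLinearMap.adjoint_comp, hS, ContinuousLinearMap.comp_apply]
  gcongr
  have : ‖C.adjoint‖ ≤ 1 := by simpa using hC
  rw [enorm_le_iff_norm_le]
  simpa using (C.adjoint).le_of_opNorm_le this (S (b i))

theorem re_inner_le_posTrace (b : HilbertBasis ι ℂ H) {X : H →L[ℂ] H}
    (hX : 0 ≤ X) (z : H) :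
    ENNReal.ofReal (inner ℂ z (X z)).re ≤ posTrace b X * ‖z‖ₑ ^ 2 := by
  obtain ⟨S, hS, rfl⟩ := exists_selfAdjoint_sq hX
  have e : S ∘L S = S.adjoint ∘L S := by rw [hS]
  rw [e, posTrace_adjoint_comp_self, inner_adjoint_comp_self, Complex.ofReal_re,
    ← enorm_sq_eq_ofReal, ← tsum_enorm_inner_sq b, ← ENNReal.tsum_mul_right]
  refine ENNReal.tsum_le_tsum fun i => ?_
  rw [← mul_pow]
  gcongr
  rw [← ContinuousLinearMap.adjoint_inner_left, hS, ← ofReal_norm, ← ofReal_norm, ← ofReal_norm,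
    ← ENNReal.ofReal_mul (norm_nonneg _)]
  exact ENNReal.ofReal_le_ofReal (norm_inner_le_norm _ _)

theorem norm_le_posTrace (b : HilbertBasis ι ℂ H) {X : H →L[ℂ] H}
    (hX : 0 ≤ X) (h : posTrace b X ≠ ∞) : ‖X‖ ≤ (posTrace b X).toReal := by
  obtain ⟨S, hS, hXS⟩ := exists_selfAdjoint_sq hX
  have e : X = S.adjoint ∘L S := by rw [hS, hXS]
  have key : ‖S‖ ≤ √(posTrace b X).toReal := by
    refine S.opNorm_le_bound (Real.sqrt_nonneg _) fun z => ?_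
    have := re_inner_le_posTrace b hX z
    rw [← ENNReal.ofReal_toReal h, enorm_sq_eq_ofReal, ← ENNReal.ofReal_mul (by positivity),
      ENNReal.ofReal_le_ofReal_iff (by positivity)] at this
    nth_rw 1 [e] at this
    rw [inner_adjoint_comp_self, Complex.ofReal_re] at this
    refine abs_le_of_sq_le_sq' ?_ (by positivity) |>.2
    rwa [mul_pow, Real.sq_sqrt (by positivity)]
  calc ‖X‖ ≤ ‖S‖ * ‖S‖ := by rw [hXS]; exact ContinuousLinearMap.opNorm_comp_le _ _
    _ ≤ √(posTrace b X).toReal * √(posTrace b X).toReal := by gcongr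
    _ = _ := Real.mul_self_sqrt (by positivity)

theorem posTrace_mono (b : HilbertBasis ι ℂ H) {X Y : H →L[ℂ] H} (h : X ≤ Y) :
    posTrace b X ≤ posTrace b Y := by
  refine ENNReal.tsum_le_tsum fun i => ENNReal.ofReal_le_ofReal ?_
  have := re_inner_nonneg (sub_nonneg.2 h) (b i)
  simpa [inner_sub_right] using this

omit [CompleteSpace H] in
theorem posTrace_add (b : HilbertBasis ι ℂ H) {X Y : H →L[ℂ] H} (hX : 0 ≤ X) (hY : 0 ≤ Y) :
    posTrace b (X + Y) = posTrace b X + posTrace b Y := by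
  unfold posTrace
  rw [← ENNReal.tsum_add]
  refine tsum_congr fun i => ?_
  rw [← ENNReal.ofReal_add (re_inner_nonneg hX _) (re_inner_nonneg hY _)]
  simp

theorem eq_zero_of_posTrace_eq_zero (b : HilbertBasis ι ℂ H) {X : H →L[ℂ] H} (hX : 0 ≤ X)
    (h : posTrace b X = 0) : X = 0 := by
  have := norm_le_posTrace b hX (by simp [h])
  simpa [h] using this

theorem eq_of_le_of_posTrace_le (b : HilbertBasis ι ℂ H) {X Y : H →L[ℂ] H} (hX : 0 ≤ X)
    (h : X ≤ Y) (hf : posTrace b X ≠ ∞) (hle : posTrace b Y ≤ posTrace b X) : X = Y := by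
  have h1 := posTrace_add b hX (sub_nonneg.2 h)
  rw [add_sub_cancel] at h1
  have h2 : posTrace b (Y - X) = 0 := by
    rw [h1] at hle
    have h3 : posTrace b X + posTrace b (Y - X) ≤ posTrace b X + 0 := by simpa using hle
    simpa using (ENNReal.add_le_add_iff_left hf).1 h3
  exact (sub_eq_zero.1 (eq_zero_of_posTrace_eq_zero b (sub_nonneg.2 h) h2)).symm

/-- For positive `X`, the diagonal is summable with sum `t` exactly when `posTrace` is `t`. -/
theorem hasSum_iff_posTrace (b : HilbertBasis ι ℂ H) {X : H →L[ℂ] H} (hX : 0 ≤ X) {t : ℝ}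
    (ht : 0 ≤ t) :
    HasSum (fun i => inner ℂ (b i) (X (b i))) (t : ℂ) ↔ posTrace b X = ENNReal.ofReal t := by
  have e : (fun i => inner ℂ (b i) (X (b i))) =
      fun i => (((inner ℂ (b i) (X (b i))).re : ℝ) : ℂ) := by
    ext i; exact (ofReal_re_inner hX _).symm
  rw [e, Complex.hasSum_ofReal]
  have h0 := fun i => re_inner_nonneg hX (b i)
  constructor
  · intro h
    rw [← h.tsum_eq, ENNReal.ofReal_tsum_of_nonneg h0 h.summable]
    rfl
  · intro h
    have hs : Summable fun i => (inner ℂ (b i) (X (b i))).re := by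
      have := ENNReal.summable_toReal (f := fun i => ENNReal.ofReal (inner ℂ (b i) (X (b i))).re)
        (by change posTrace b X ≠ ∞; simp [h])
      simpa [ENNReal.toReal_ofReal (h0 _)] using this
    have h2 := hs.hasSum
    convert h2
    have h3 := ENNReal.ofReal_tsum_of_nonneg h0 hs
    have h4 : ENNReal.ofReal (∑' i, (inner ℂ (b i) (X (b i))).re) = ENNReal.ofReal t := h3.trans h
    exact ((ENNReal.ofReal_eq_ofReal_iff (tsum_nonneg h0) ht).1 h4).symm

theorem isTraceClass_iff {X : H →L[ℂ] H} (hX : 0 ≤ X) :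
    IsTraceClass X ↔ posTrace (someBasis H) X ≠ ∞ := by
  rw [IsTraceClass, CFC.abs_of_nonneg X hX]
  have h0 := fun i => re_inner_nonneg hX (someBasis H i)
  constructor
  · intro h
    have := (ENNReal.ofReal_tsum_of_nonneg h0 h)
    change _ = posTrace _ X at this
    rw [← this]; simp
  · intro h
    have := ENNReal.summable_toReal
      (f := fun i => ENNReal.ofReal (inner ℂ (someBasis H i) (X (someBasis H i))).re) h
    simpa [ENNReal.toReal_ofReal (h0 _)] using this

theorem isDensityOperator_iff {X : H →L[ℂ] H} :
    IsDensityOperator X ↔ 0 ≤ X ∧ posTrace (someBasis H) X = 1 := by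
  constructor
  · rintro ⟨h0, h1, h2⟩
    refine ⟨h0, ?_⟩
    have h3 := (isTraceClass_iff h0).1 h1
    have h4 := (hasSum_iff_posTrace (someBasis H) h0 ENNReal.toReal_nonneg).2
      (ENNReal.ofReal_toReal h3).symm
    have h5 := h4.tsum_eq
    change trace X = _ at h5
    rw [h2] at h5
    rw [← ENNReal.ofReal_toReal h3]
    have : (posTrace (someBasis H) X).toReal = 1 := by exact_mod_cast h5.symm
    simp [this]
  · rintro ⟨h0, h1⟩
    refine ⟨h0, (isTraceClass_iff h0).2 (by simp [h1]), ?_⟩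
    have := (hasSum_iff_posTrace (someBasis H) h0 zero_le_one).2 (by simpa using h1)
    exact this.tsum_eq.trans Complex.ofReal_one

/-- The trace of the compression of an operator to a finite-dimensional subspace. -/
def subspaceTrace (V : Submodule ℂ H) [FiniteDimensional ℂ V] (X : H →L[ℂ] H) : ℝ :=
  ∑ k, (inner ℂ (stdOrthonormalBasis ℂ V k : H) (X (stdOrthonormalBasis ℂ V k : H))).re

omit [CompleteSpace H] in
theorem starProjection_eq_sum (V : Submodule ℂ H) [FiniteDimensional ℂ V] (x : H) :
    V.starProjection x =
      ∑ k, inner ℂ (stdOrthonormalBasis ℂ V k : H) x • (stdOrthonormalBasis ℂ V k : H) := by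
  rw [Submodule.starProjection_apply,
    (stdOrthonormalBasis ℂ V).orthogonalProjectionOnto_apply_eq_sum]
  simp

theorem hasSum_inner_comp_starProjection (b : HilbertBasis ι ℂ H) (V : Submodule ℂ H)
    [FiniteDimensional ℂ V] {X : H →L[ℂ] H} (hX : 0 ≤ X) :
    HasSum (fun i => inner ℂ (b i) ((X ∘L V.starProjection) (b i))) (subspaceTrace V X : ℂ) := by
  have e : ∀ i, inner ℂ (b i) ((X ∘L V.starProjection) (b i)) =
      ∑ k, inner ℂ (stdOrthonormalBasis ℂ V k : H) (b i) *
        inner ℂ (b i) (X (stdOrthonormalBasis ℂ V k : H)) := by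
    intro i
    rw [ContinuousLinearMap.comp_apply, starProjection_eq_sum, map_sum, inner_sum]
    simp [inner_smul_right]
  simp_rw [e, subspaceTrace, Complex.ofReal_sum, ofReal_re_inner hX]
  exact hasSum_sum fun k _ => b.hasSum_inner_mul_inner _ _

theorem trace_comp_starProjection (V : Submodule ℂ H) [FiniteDimensional ℂ V] {X : H →L[ℂ] H}
    (hX : 0 ≤ X) : trace (X ∘L V.starProjection) = subspaceTrace V X :=
  (hasSum_inner_comp_starProjection (someBasis H) V hX).tsum_eq

omit [CompleteSpace H] in
theorem subspaceTrace_nonneg (V : Submodule ℂ H) [FiniteDimensional ℂ V] {X : H →L[ℂ] H}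
    (hX : 0 ≤ X) : 0 ≤ subspaceTrace V X :=
  Finset.sum_nonneg fun _ _ => re_inner_nonneg hX _

theorem starProjection_conj_nonneg (V : Submodule ℂ H) [V.HasOrthogonalProjection] {X : H →L[ℂ] H}
    (hX : 0 ≤ X) : 0 ≤ V.starProjection ∘L X ∘L V.starProjection := by
  simpa [(isSelfAdjoint_starProjection V).adjoint_eq] using
    nonneg_adjoint_conj hX V.starProjection

omit [CompleteSpace H] in
theorem subspaceTrace_starProjection_conj (V : Submodule ℂ H) [FiniteDimensional ℂ V]
    (X : H →L[ℂ] H) :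
    subspaceTrace V (V.starProjection ∘L X ∘L V.starProjection) = subspaceTrace V X := by
  refine Finset.sum_congr rfl fun k _ => ?_
  have hk : V.starProjection (stdOrthonormalBasis ℂ V k : H) = stdOrthonormalBasis ℂ V k :=
    Submodule.starProjection_eq_self_iff.2 (stdOrthonormalBasis ℂ V k).2
  simp only [ContinuousLinearMap.comp_apply]
  rw [← Submodule.inner_starProjection_left_eq_right, hk]

theorem posTrace_starProjection_conj (b : HilbertBasis ι ℂ H) (V : Submodule ℂ H)
    [FiniteDimensional ℂ V] {X : H →L[ℂ] H} (hX : 0 ≤ X) :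
    posTrace b (V.starProjection ∘L X ∘L V.starProjection) =
      ENNReal.ofReal (subspaceTrace V X) := by
  have h0 := starProjection_conj_nonneg V hX
  have h := hasSum_inner_comp_starProjection b V h0
  rw [← hasSum_iff_posTrace b h0 (subspaceTrace_nonneg V hX)]
  convert h using 1
  · ext i
    have hi : V.starProjection (V.starProjection (b i)) = V.starProjection (b i) :=
      Submodule.starProjection_eq_self_iff.2 (Submodule.starProjection_apply_mem _ _)
    simp only [ContinuousLinearMap.comp_apply, hi]
  · rw [subspaceTrace_starProjection_conj]

theorem subspaceTrace_eq_posTrace (b : HilbertBasis ι ℂ H) (V : Submodule ℂ H)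
    [FiniteDimensional ℂ V] {X : H →L[ℂ] H} (hX : 0 ≤ X) (hV : ∀ z, X z ∈ V) :
    ENNReal.ofReal (subspaceTrace V X) = posTrace b X := by
  rw [← posTrace_starProjection_conj b V hX]
  congr 1
  have h1 : V.starProjection ∘L X = X := by
    ext z
    exact Submodule.starProjection_eq_self_iff.2 (hV z)
  have h2 : X ∘L V.starProjection = X := by
    have := congrArg ContinuousLinearMap.adjoint h1
    rwa [ContinuousLinearMap.adjoint_comp, (isSelfAdjoint_starProjection V).adjoint_eq,
      hX.isSelfAdjoint.adjoint_eq] at this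
  rw [h2, h1]

theorem posTrace_starProjection_conj_eq_tsum (b : HilbertBasis ι ℂ H) (V : Submodule ℂ H)
    [V.HasOrthogonalProjection] (S : H →L[ℂ] H) (hS : S.adjoint = S) :
    posTrace b (V.starProjection ∘L (S ∘L S) ∘L V.starProjection) =
      ∑' i, ‖V.starProjection (S (b i))‖ₑ ^ 2 := by
  have e : V.starProjection ∘L (S ∘L S) ∘L V.starProjection =
      (S ∘L V.starProjection).adjoint ∘L (S ∘L V.starProjection) := by
    rw [ContinuousLinearMap.adjoint_comp, hS, (isSelfAdjoint_starProjection V).adjoint_eq]; rfl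
  rw [e, posTrace_adjoint_comp_self, tsum_enorm_sq_adjoint b b, ContinuousLinearMap.adjoint_comp,
    hS, (isSelfAdjoint_starProjection V).adjoint_eq]
  rfl

theorem posTrace_eq_tsum (b : HilbertBasis ι ℂ H) (S : H →L[ℂ] H) (hS : S.adjoint = S) :
    posTrace b (S ∘L S) = ∑' i, ‖S (b i)‖ₑ ^ 2 := by
  have e : S ∘L S = S.adjoint ∘L S := by rw [hS]
  rw [e, posTrace_adjoint_comp_self]

/-- The trace of a positive operator splits along a subspace and its orthogonal complement. -/
theorem posTrace_eq_add_orthogonal (b : HilbertBasis ι ℂ H) (V : Submodule ℂ H)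
    [FiniteDimensional ℂ V] {X : H →L[ℂ] H} (hX : 0 ≤ X) :
    posTrace b X = ENNReal.ofReal (subspaceTrace V X) +
      posTrace b (Vᗮ.starProjection ∘L X ∘L Vᗮ.starProjection) := by
  rw [← posTrace_starProjection_conj b V hX]
  obtain ⟨S, hS, rfl⟩ := exists_selfAdjoint_sq hX
  rw [posTrace_starProjection_conj_eq_tsum b V S hS, posTrace_starProjection_conj_eq_tsum b Vᗮ S hS,
    posTrace_eq_tsum b S hS, ← ENNReal.tsum_add]
  refine tsum_congr fun i => ?_
  simp_rw [enorm_sq_eq_ofReal]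
  rw [← ENNReal.ofReal_add (by positivity) (by positivity),
    ← Submodule.norm_sq_eq_add_norm_sq_starProjection]

theorem subspaceTrace_le_posTrace (b : HilbertBasis ι ℂ H) (V : Submodule ℂ H)
    [FiniteDimensional ℂ V] {X : H →L[ℂ] H} (hX : 0 ≤ X) :
    ENNReal.ofReal (subspaceTrace V X) ≤ posTrace b X := by
  rw [posTrace_eq_add_orthogonal b V hX]
  exact le_self_add

/-- A pointwise comparison of projections gives a comparison of traces of compressions. -/
theorem subspaceTrace_le_add (b : HilbertBasis ι ℂ H) (V W : Submodule ℂ H)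
    [FiniteDimensional ℂ V] [FiniteDimensional ℂ W] {c : ℝ} (hc : 0 ≤ c)
    (h : ∀ x, ‖V.starProjection x‖ ^ 2 ≤ ‖W.starProjection x‖ ^ 2 + c * ‖x‖ ^ 2)
    {X : H →L[ℂ] H} (hX : 0 ≤ X) (hf : posTrace b X ≠ ∞) :
    subspaceTrace V X ≤ subspaceTrace W X + c * (posTrace b X).toReal := by
  have h0 := subspaceTrace_nonneg W hX
  rw [← ENNReal.ofReal_le_ofReal_iff (by positivity), ENNReal.ofReal_add h0 (by positivity),
    ENNReal.ofReal_mul hc, ENNReal.ofReal_toReal hf, ← posTrace_starProjection_conj b V hX,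
    ← posTrace_starProjection_conj b W hX]
  obtain ⟨S, hS, rfl⟩ := exists_selfAdjoint_sq hX
  rw [posTrace_starProjection_conj_eq_tsum b V S hS, posTrace_starProjection_conj_eq_tsum b W S hS,
    posTrace_eq_tsum b S hS, ← ENNReal.tsum_mul_left, ← ENNReal.tsum_add]
  refine ENNReal.tsum_le_tsum fun i => ?_
  simp_rw [enorm_sq_eq_ofReal]
  rw [← ENNReal.ofReal_mul hc, ← ENNReal.ofReal_add (by positivity) (by positivity)]
  exact ENNReal.ofReal_le_ofReal (h _)

/-- If `V` carries almost all of the trace of `X`, then the quadratic form of `X` is almost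
determined by the compression of `X` to `V`. -/
theorem sqrt_re_inner_starProjection_le (b : HilbertBasis ι ℂ H) (V : Submodule ℂ H)
    [FiniteDimensional ℂ V] {X : H →L[ℂ] H} (hX : 0 ≤ X) (hf : posTrace b X ≤ 1) (z : H) :
    √(inner ℂ (V.starProjection z) (X (V.starProjection z))).re ≤
      √(inner ℂ z (X z)).re + √(1 - subspaceTrace V X) * ‖z‖ := by
  have hs := posTrace_eq_add_orthogonal b V hX
  have hq := re_inner_le_posTrace b (starProjection_conj_nonneg Vᗮ hX) z
  have h0 := subspaceTrace_nonneg V hX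
  have hle : posTrace b (Vᗮ.starProjection ∘L X ∘L Vᗮ.starProjection) ≤
      ENNReal.ofReal (1 - subspaceTrace V X) := by
    rw [ENNReal.ofReal_sub _ h0, ENNReal.ofReal_one]
    refine ENNReal.le_sub_of_add_le_left ENNReal.ofReal_ne_top ?_
    rwa [← hs]
  have h1 : 0 ≤ 1 - subspaceTrace V X := by
    have := (subspaceTrace_le_posTrace b V hX).trans hf
    rw [← ENNReal.ofReal_one, ENNReal.ofReal_le_ofReal_iff zero_le_one] at this
    linarith
  have hq2 : (inner ℂ (Vᗮ.starProjection z) (X (Vᗮ.starProjection z))).re ≤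
      (1 - subspaceTrace V X) * ‖z‖ ^ 2 := by
    rw [← ENNReal.ofReal_le_ofReal_iff (by positivity), ENNReal.ofReal_mul h1,
      ← enorm_sq_eq_ofReal]
    refine le_trans (le_of_eq ?_) (hq.trans (by gcongr))
    simp only [ContinuousLinearMap.comp_apply]
    rw [Submodule.inner_starProjection_left_eq_right]
  obtain ⟨S, hS, rfl⟩ := exists_selfAdjoint_sq hX
  have e : ∀ x, (inner ℂ x ((S ∘L S) x)).re = ‖S x‖ ^ 2 := by
    intro x
    have e : S ∘L S = S.adjoint ∘L S := by rw [hS]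
    rw [e, inner_adjoint_comp_self, Complex.ofReal_re]
  rw [e] at hq2 ⊢
  rw [e, Real.sqrt_sq (norm_nonneg _), Real.sqrt_sq (norm_nonneg _)]
  have h2 : ‖S (Vᗮ.starProjection z)‖ ≤ √(1 - subspaceTrace V (S ∘L S)) * ‖z‖ := by
    refine (abs_le_of_sq_le_sq' ?_ (by positivity)).2
    rwa [mul_pow, Real.sq_sqrt h1]
  have h3 : S (V.starProjection z) = S z - S (Vᗮ.starProjection z) := by
    rw [← map_sub]
    congr 1
    rw [eq_sub_iff_add_eq, V.starProjection_add_starProjection_orthogonal]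
  rw [h3]
  exact (norm_sub_le _ _).trans (by gcongr)

theorem tendsto_posTrace_conj (b : HilbertBasis ι ℂ H) {T : ℕ → H →L[ℂ] H}
    (hT : ∀ n, (T n).adjoint = T n) (hn : ∀ n, ‖T n‖ ≤ 1)
    (hlim : ∀ z, Tendsto (fun n => T n z) atTop (𝓝 z)) {X : H →L[ℂ] H} (hX : 0 ≤ X)
    (hf : posTrace b X ≠ ∞) :
    Tendsto (fun n => (posTrace b (T n ∘L X ∘L T n)).toReal) atTop (𝓝 (posTrace b X).toReal) := by
  obtain ⟨S, hS, rfl⟩ := exists_selfAdjoint_sq hX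
  have e : ∀ n, T n ∘L (S ∘L S) ∘L T n = (S ∘L T n).adjoint ∘L (S ∘L T n) := by
    intro n
    rw [ContinuousLinearMap.adjoint_comp, hS, hT]; rfl
  have e2 : ∀ n, posTrace b (T n ∘L (S ∘L S) ∘L T n) = ∑' i, ‖T n (S (b i))‖ₑ ^ 2 := by
    intro n
    rw [e, posTrace_adjoint_comp_self, tsum_enorm_sq_adjoint b b, ContinuousLinearMap.adjoint_comp,
      hS, hT]
    rfl
  rw [posTrace_eq_tsum b S hS] at hf ⊢
  simp_rw [e2]
  have e3 : ∀ f : ι → H, (∑' i, ‖f i‖ₑ ^ 2).toReal = ∑' i, ‖f i‖ ^ 2 := by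
    intro f
    rw [ENNReal.tsum_toReal_eq (fun i => by simp)]
    simp
  rw [e3 fun i => S (b i)]
  simp_rw [e3 fun i => T _ (S (b i))]
  have hsum : Summable fun i => ‖S (b i)‖ ^ 2 := by
    simpa using ENNReal.summable_toReal hf
  refine tendsto_tsum_of_dominated_convergence hsum (fun i => ?_) (Eventually.of_forall fun n i => ?_)
  · exact ((hlim (S (b i))).norm).pow 2
  · rw [Real.norm_of_nonneg (by positivity)]
    gcongr
    simpa using (T n).le_of_opNorm_le (hn n) (S (b i))

end PositiveTrace

section PartialTrace

open scoped ENNReal InnerProduct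

variable {ι κ : Type*} {H G K : Type*} [NormedAddCommGroup H] [InnerProductSpace ℂ H]
  [NormedAddCommGroup G] [InnerProductSpace ℂ G] [NormedAddCommGroup K] [InnerProductSpace ℂ K]

/-- A bilinear map exhibiting `K` as a Hilbert space tensor product of `H` and `G`. -/
structure IsHilbertTensor (L : H →L[ℂ] G →L[ℂ] K) : Prop where
  inner_map : ∀ x y u v, inner ℂ (L x y) (L u v) = inner ℂ x u * inner ℂ y v
  dense : ∀ z : K, (∀ x y, inner ℂ (L x y) z = 0) → z = 0

theorem IsHilbertTensor.flip {L : H →L[ℂ] G →L[ℂ] K} (hL : IsHilbertTensor L) :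
    IsHilbertTensor L.flip where
  inner_map x y u v := by
    simp only [ContinuousLinearMap.flip_apply]
    rw [hL.inner_map, mul_comm]
  dense z hz := hL.dense z fun x y => hz y x

theorem IsHilbertTensor.exists_basis [CompleteSpace K] {L : H →L[ℂ] G →L[ℂ] K}
    (hL : IsHilbertTensor L) (b : HilbertBasis ι ℂ H) (c : HilbertBasis κ ℂ G) :
    ∃ d : HilbertBasis (ι × κ) ℂ K, ∀ p, d p = L (b p.1) (c p.2) := by
  classical
  have ho : Orthonormal ℂ fun p : ι × κ => L (b p.1) (c p.2) := by
    rw [orthonormal_iff_ite]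
    rintro ⟨i, j⟩ ⟨k, l⟩
    rw [hL.inner_map, orthonormal_iff_ite.1 b.orthonormal, orthonormal_iff_ite.1 c.orthonormal]
    by_cases h1 : i = k <;> by_cases h2 : j = l <;> simp [h1, h2]
  have hbot : (Submodule.span ℂ (Set.range fun p : ι × κ => L (b p.1) (c p.2)))ᗮ = ⊥ := by
    rw [Submodule.eq_bot_iff]
    intro z hz
    have hz' : ∀ i j, inner ℂ (L (b i) (c j)) z = 0 := fun i j =>
      (Submodule.mem_orthogonal _ _).1 hz _ (Submodule.subset_span ⟨(i, j), rfl⟩)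
    refine hL.dense z fun x y => ?_
    have h1 : ∀ i, innerSL ℂ z ∘L L (b i) = 0 := fun i =>
      ContinuousLinearMap.ext_on (Submodule.dense_iff_topologicalClosure_eq_top.2 c.dense_span) <| by
        rintro _ ⟨j, rfl⟩
        simpa using inner_eq_zero_symm.1 (hz' i j)
    have h2 : innerSL ℂ z ∘L L.flip y = 0 :=
      ContinuousLinearMap.ext_on (Submodule.dense_iff_topologicalClosure_eq_top.2 b.dense_span) <| by
        rintro _ ⟨i, rfl⟩
        simpa using DFunLike.congr_fun (h1 i) y
    exact inner_eq_zero_symm.1 (by simpa using DFunLike.congr_fun h2 x)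
  exact ⟨HilbertBasis.mkOfOrthogonalEqBot ho hbot, fun p => by
    rw [HilbertBasis.coe_mkOfOrthogonalEqBot]⟩

variable [CompleteSpace H] [CompleteSpace K]

/-- The partial trace over the second factor. -/
def partialTr (L : H →L[ℂ] G →L[ℂ] K) (c : HilbertBasis κ ℂ G) (X : K →L[ℂ] K) : H →L[ℂ] H :=
  ∑' j, (L.flip (c j)).adjoint ∘L X ∘L L.flip (c j)

variable {L : H →L[ℂ] G →L[ℂ] K} {X : K →L[ℂ] K}

theorem posTrace_eq_tsum_slices (hL : IsHilbertTensor L) (b : HilbertBasis ι ℂ H)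
    (c : HilbertBasis κ ℂ G) {μ : Type*} (d : HilbertBasis μ ℂ K) (hX : 0 ≤ X) :
    posTrace d X = ∑' j, posTrace b ((L.flip (c j)).adjoint ∘L X ∘L L.flip (c j)) := by
  obtain ⟨e, he⟩ := hL.exists_basis b c
  rw [posTrace_eq_posTrace d e hX]
  unfold posTrace
  rw [ENNReal.tsum_prod', ENNReal.tsum_comm]
  refine tsum_congr fun j => tsum_congr fun i => ?_
  rw [he, ContinuousLinearMap.comp_apply, ContinuousLinearMap.adjoint_inner_right]
  rfl

theorem hasSum_partialTr (hL : IsHilbertTensor L) (c : HilbertBasis κ ℂ G) {μ : Type*}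
    (d : HilbertBasis μ ℂ K) (hX : 0 ≤ X) (hf : posTrace d X ≠ ∞) :
    HasSum (fun j => (L.flip (c j)).adjoint ∘L X ∘L L.flip (c j)) (partialTr L c X) := by
  rw [posTrace_eq_tsum_slices hL (someBasis H) c d hX] at hf
  refine Summable.hasSum (Summable.of_norm_bounded (ENNReal.summable_toReal hf) fun j => ?_)
  exact norm_le_posTrace _ (nonneg_adjoint_conj hX _) (ENNReal.ne_top_of_tsum_ne_top hf j)

theorem hasSum_inner_partialTr (hL : IsHilbertTensor L) (c : HilbertBasis κ ℂ G) {μ : Type*}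
    (d : HilbertBasis μ ℂ K) (hX : 0 ≤ X) (hf : posTrace d X ≠ ∞) (x : H) :
    HasSum (fun j => (inner ℂ (L x (c j)) (X (L x (c j)))).re)
      (inner ℂ x (partialTr L c X x)).re := by
  have h1 := (hasSum_partialTr hL c d hX hf).mapL (ContinuousLinearMap.apply ℂ H x)
  have h2 := Complex.hasSum_re (h1.mapL (innerSL ℂ x))
  convert h2 using 2 with j
  · simp [ContinuousLinearMap.adjoint_inner_right]
  · simp

theorem partialTr_nonneg (hL : IsHilbertTensor L) (c : HilbertBasis κ ℂ G) {μ : Type*}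
    (d : HilbertBasis μ ℂ K) (hX : 0 ≤ X) (hf : posTrace d X ≠ ∞) : 0 ≤ partialTr L c X :=
  (hasSum_partialTr hL c d hX hf).nonneg fun _ => nonneg_adjoint_conj hX _

theorem posTrace_partialTr (hL : IsHilbertTensor L) (b : HilbertBasis ι ℂ H)
    (c : HilbertBasis κ ℂ G) {μ : Type*}
    (d : HilbertBasis μ ℂ K) (hX : 0 ≤ X) (hf : posTrace d X ≠ ∞) :
    posTrace b (partialTr L c X) = posTrace d X := by
  rw [posTrace_eq_tsum_slices hL b c d hX]
  unfold posTrace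
  rw [ENNReal.tsum_comm]
  refine tsum_congr fun i => ?_
  have h := hasSum_inner_partialTr hL c d hX hf (b i)
  rw [← h.tsum_eq, ENNReal.ofReal_tsum_of_nonneg (fun _ => re_inner_nonneg hX _) h.summable]
  refine tsum_congr fun j => ?_
  rw [ContinuousLinearMap.comp_apply, ContinuousLinearMap.adjoint_inner_right]
  rfl

theorem partialTr_le_iff (hL : IsHilbertTensor L) (c : HilbertBasis κ ℂ G) {μ : Type*}
    (d : HilbertBasis μ ℂ K) (hX : 0 ≤ X) (hf : posTrace d X ≠ ∞) {R : H →L[ℂ] H}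
    (hR : IsSelfAdjoint R) :
    partialTr L c X ≤ R ↔ ∀ (x : H) (J : Finset κ),
      ∑ j ∈ J, (inner ℂ (L x (c j)) (X (L x (c j)))).re ≤ (inner ℂ x (R x)).re := by
  rw [le_iff_re_inner_le (partialTr_nonneg hL c d hX hf).isSelfAdjoint hR]
  refine forall_congr' fun x => ?_
  have h := hasSum_inner_partialTr hL c d hX hf x
  constructor
  · exact fun hle J => (sum_le_hasSum J (fun _ _ => re_inner_nonneg hX _) h).trans hle
  · exact fun hJ => hasSum_le_of_sum_le h hJ

/-- Compressing by a product of contractions decreases the partial trace. -/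
theorem partialTr_conj_le [CompleteSpace G] (hL : IsHilbertTensor L) (c : HilbertBasis κ ℂ G) {μ : Type*}
    (d : HilbertBasis μ ℂ K) (hX : 0 ≤ X) (hf : posTrace d X ≠ ∞) {T : K →L[ℂ] K}
    {P : H →L[ℂ] H} {Q : G →L[ℂ] G} (hT : T.adjoint = T) (hT1 : ‖T‖ ≤ 1) (hP : P.adjoint = P)
    (hQ : ‖Q‖ ≤ 1) (hTL : ∀ x y, T (L x y) = L (P x) (Q y)) :
    partialTr L c (T ∘L X ∘L T) ≤ P ∘L partialTr L c X ∘L P := by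
  have hX' : 0 ≤ T ∘L X ∘L T := by simpa [hT] using nonneg_adjoint_conj hX T
  have hf' : posTrace d (T ∘L X ∘L T) ≠ ∞ :=
    ne_top_of_le_ne_top hf (by simpa [hT] using posTrace_conj_le d d hX hT1)
  have h0 := partialTr_nonneg hL c d hX hf
  have hR : 0 ≤ P ∘L partialTr L c X ∘L P := by simpa [hP] using nonneg_adjoint_conj h0 P
  rw [le_iff_re_inner_le (partialTr_nonneg hL c d hX' hf').isSelfAdjoint hR.isSelfAdjoint]
  intro x
  have h1 := hasSum_inner_partialTr hL c d hX' hf' x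
  have h2 := hasSum_inner_partialTr hL c d hX hf (P x)
  have h3 : inner ℂ x ((P ∘L partialTr L c X ∘L P) x) =
      inner ℂ (P x) (partialTr L c X (P x)) := by
    rw [ContinuousLinearMap.comp_apply, ← ContinuousLinearMap.adjoint_inner_left, hP]; rfl
  have hB := nonneg_adjoint_conj hX (L (P x))
  have h4 := posTrace_conj_le c c hB hQ
  have h5 := ENNReal.ofReal_tsum_of_nonneg (fun j => re_inner_nonneg hX' (L x (c j))) h1.summable
  have h6 := ENNReal.ofReal_tsum_of_nonneg (fun j => re_inner_nonneg hX (L (P x) (c j))) h2.summable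
  rw [h3, ← ENNReal.ofReal_le_ofReal_iff (re_inner_nonneg h0 _), ← h1.tsum_eq, ← h2.tsum_eq, h5, h6]
  refine le_trans (le_of_eq ?_) (h4.trans (le_of_eq ?_))
  · refine tsum_congr fun j => ?_
    congr 2
    simp only [ContinuousLinearMap.comp_apply]
    rw [← ContinuousLinearMap.adjoint_inner_left, hT, ContinuousLinearMap.adjoint_inner_right,
      ContinuousLinearMap.adjoint_inner_right, hTL]
  · refine tsum_congr fun j => ?_
    congr 2
    simp only [ContinuousLinearMap.comp_apply]
    rw [ContinuousLinearMap.adjoint_inner_right]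

end PartialTrace

section Truncation

variable {H : Type*} [NormedAddCommGroup H] [InnerProductSpace ℂ H]

theorem truncSpan_mono (e : HilbertBasis ℕ ℂ H) : Monotone (truncSpan e) := by
  intro m n hmn
  refine Submodule.span_mono ?_
  rintro _ ⟨k, rfl⟩
  exact ⟨⟨k, k.2.trans_le hmn⟩, rfl⟩

theorem tendsto_truncProj [CompleteSpace H] (e : HilbertBasis ℕ ℂ H) (x : H) :
    Tendsto (fun n => truncProj e n x) atTop (𝓝 x) := by
  refine Submodule.starProjection_tendsto_self (truncSpan e) (truncSpan_mono e) x ?_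
  rw [← e.dense_span]
  refine Submodule.topologicalClosure_mono (Submodule.span_le.2 ?_)
  rintro _ ⟨k, rfl⟩
  exact Submodule.mem_iSup_of_mem (k + 1) (Submodule.subset_span ⟨⟨k, by simp⟩, rfl⟩)

theorem adjoint_truncProj [CompleteSpace H] (e : HilbertBasis ℕ ℂ H) (n : ℕ) :
    (truncProj e n).adjoint = truncProj e n :=
  (isSelfAdjoint_starProjection _).adjoint_eq

theorem norm_truncProj_le (e : HilbertBasis ℕ ℂ H) (n : ℕ) : ‖truncProj e n‖ ≤ 1 :=
  Submodule.starProjection_norm_le _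

theorem truncProj_truncProj (e : HilbertBasis ℕ ℂ H) {m n : ℕ} (h : m ≤ n) (x : H) :
    truncProj e n (truncProj e m x) = truncProj e m x :=
  Submodule.starProjection_eq_self_iff.2
    (truncSpan_mono e h (Submodule.starProjection_apply_mem _ _))

end Truncation

section Abstract

variable {H G K : Type*} [NormedAddCommGroup H] [InnerProductSpace ℂ H]
  [NormedAddCommGroup G] [InnerProductSpace ℂ G] [NormedAddCommGroup K] [InnerProductSpace ℂ K]
  {L : H →L[ℂ] G →L[ℂ] K}

theorem IsHilbertTensor.ext_inner (hL : IsHilbertTensor L) {z w : K}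
    (h : ∀ x y, inner ℂ (L x y) z = inner ℂ (L x y) w) : z = w :=
  sub_eq_zero.1 (hL.dense _ fun x y => by rw [inner_sub_right, h, sub_self])

theorem IsHilbertTensor.ext_op [CompleteSpace K] (hL : IsHilbertTensor L) {A B : K →L[ℂ] K}
    (h : ∀ x y, A (L x y) = B (L x y)) : A = B := by
  have : A.adjoint = B.adjoint := by
    ext z
    refine hL.ext_inner fun x y => ?_
    rw [ContinuousLinearMap.adjoint_inner_right, ContinuousLinearMap.adjoint_inner_right, h]
  simpa using congrArg ContinuousLinearMap.adjoint this

theorem IsHilbertTensor.adjoint_eq [CompleteSpace H] [CompleteSpace G] [CompleteSpace K]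
    (hL : IsHilbertTensor L) {T : K →L[ℂ] K} {P : H →L[ℂ] H} {Q : G →L[ℂ] G}
    (hT : ∀ x y, T (L x y) = L (P x) (Q y)) (hP : P.adjoint = P) (hQ : Q.adjoint = Q) :
    T.adjoint = T := by
  refine hL.ext_op fun x y => hL.ext_inner fun u v => ?_
  rw [ContinuousLinearMap.adjoint_inner_right, hT, hT, hL.inner_map, hL.inner_map,
    ← ContinuousLinearMap.adjoint_inner_right, ← ContinuousLinearMap.adjoint_inner_right Q, hP, hQ]

end Abstract

section Concrete

variable {H₁ H₂ : Type*} [NormedAddCommGroup H₁] [InnerProductSpace ℂ H₁]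
  [NormedAddCommGroup H₂] [InnerProductSpace ℂ H₂]

variable (H₁ H₂) in
/-- The canonical bilinear map into the Hilbert space tensor product. -/
def tensorMap : H₁ →L[ℂ] H₂ →L[ℂ] HTensor H₁ H₂ :=
  (ContinuousLinearMap.compL ℂ H₂ (H₁ ⊗[ℂ] H₂) (HTensor H₁ H₂)
    UniformSpace.Completion.toComplL) ∘L TensorProduct.mkL ℂ H₁ H₂

theorem tensorMap_apply (x : H₁) (y : H₂) :
    tensorMap H₁ H₂ x y = ((x ⊗ₜ[ℂ] y : H₁ ⊗[ℂ] H₂) : HTensor H₁ H₂) := rfl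

theorem isHilbertTensor_tensorMap : IsHilbertTensor (tensorMap H₁ H₂) where
  inner_map x y u v := by
    rw [tensorMap_apply, tensorMap_apply, UniformSpace.Completion.inner_coe,
      TensorProduct.inner_tmul]
  dense z hz := by
    have h : ∀ w : HTensor H₁ H₂, inner ℂ w z = 0 := by
      intro w
      induction w using UniformSpace.Completion.induction_on with
      | hp => exact isClosed_eq (by fun_prop) continuous_const
      | ih a =>
        induction a using TensorProduct.induction_on with
        | zero => rw [UniformSpace.Completion.coe_zero, inner_zero_left]
        | tmul x y => exact hz x y
        | add a b ha hb => rw [UniformSpace.Completion.coe_add, inner_add_left, ha, hb, add_zero]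
    exact inner_self_eq_zero.1 (h z)

theorem opTensor_tensorMap (A : H₁ →L[ℂ] H₁) (B : H₂ →L[ℂ] H₂) (x : H₁) (y : H₂) :
    opTensor A B (tensorMap H₁ H₂ x y) = tensorMap H₁ H₂ (A x) (B y) := by
  rw [tensorMap_apply, opTensor, ContinuousLinearMap.completion_apply_coe]
  rfl

variable [CompleteSpace H₁] [CompleteSpace H₂]

theorem partialTrace₂_eq_partialTr (F : HTensor H₁ H₂ →L[ℂ] HTensor H₁ H₂) :
    partialTrace₂ F = partialTr (tensorMap H₁ H₂) (someBasis H₂) F := rfl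

theorem partialTrace₁_eq_partialTr (F : HTensor H₁ H₂ →L[ℂ] HTensor H₁ H₂) :
    partialTrace₁ F = partialTr (tensorMap H₁ H₂).flip (someBasis H₁) F := rfl

variable (e₁ : HilbertBasis ℕ ℂ H₁) (e₂ : HilbertBasis ℕ ℂ H₂)

omit [CompleteSpace H₁] [CompleteSpace H₂] in
theorem truncTensor_tensorMap (n : ℕ) (x : H₁) (y : H₂) :
    truncTensor e₁ e₂ n (tensorMap H₁ H₂ x y) =
      tensorMap H₁ H₂ (truncProj e₁ n x) (truncProj e₂ n y) :=
  opTensor_tensorMap _ _ _ _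

theorem adjoint_truncTensor (n : ℕ) : (truncTensor e₁ e₂ n).adjoint = truncTensor e₁ e₂ n :=
  isHilbertTensor_tensorMap.adjoint_eq (truncTensor_tensorMap e₁ e₂ n) (adjoint_truncProj e₁ n)
    (adjoint_truncProj e₂ n)

omit [CompleteSpace H₁] [CompleteSpace H₂] in
theorem truncTensor_comp {m n : ℕ} (h : m ≤ n) :
    truncTensor e₁ e₂ n ∘L truncTensor e₁ e₂ m = truncTensor e₁ e₂ m :=
  isHilbertTensor_tensorMap.ext_op fun x y => by
    simp only [ContinuousLinearMap.comp_apply, truncTensor_tensorMap, truncProj_truncProj _ h]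

/-- The range of `P_{n,1} ⊗ P_{n,2}`. -/
def truncRange (n : ℕ) : Submodule ℂ (HTensor H₁ H₂) := (truncTensor e₁ e₂ n).range

instance instFiniteDimensionalTruncRange (n : ℕ) : FiniteDimensional ℂ (truncRange e₁ e₂ n) := by
  let W := Submodule.map₂ (tensorMap H₁ H₂).toLinearMap₁₂ (truncSpan e₁ n) (truncSpan e₂ n)
  have hW : FiniteDimensional ℂ W := Module.Finite.iff_fg.2
    (Submodule.FG.map₂ _ (Module.Finite.iff_fg.1 inferInstance)
      (Module.Finite.iff_fg.1 inferInstance))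
  have h : W.starProjection ∘L truncTensor e₁ e₂ n = truncTensor e₁ e₂ n := by
    refine isHilbertTensor_tensorMap.ext_op fun x y => ?_
    rw [ContinuousLinearMap.comp_apply, truncTensor_tensorMap]
    exact Submodule.starProjection_eq_self_iff.2 (Submodule.apply_mem_map₂ _
      (Submodule.starProjection_apply_mem _ _) (Submodule.starProjection_apply_mem _ _))
  refine Submodule.finiteDimensional_of_le (S₂ := W) ?_
  rintro _ ⟨z, rfl⟩
  change truncTensor e₁ e₂ n z ∈ W
  rw [← h]
  exact Submodule.starProjection_apply_mem _ _

theorem truncTensor_eq_starProjection (n : ℕ) :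
    truncTensor e₁ e₂ n = (truncRange e₁ e₂ n).starProjection := by
  have h : IsStarProjection (truncTensor e₁ e₂ n) :=
    ⟨truncTensor_comp e₁ e₂ le_rfl, adjoint_truncTensor e₁ e₂ n⟩
  obtain ⟨_, h⟩ := isStarProjection_iff_eq_starProjection_range.1 h
  exact h

theorem norm_truncTensor_le (n : ℕ) : ‖truncTensor e₁ e₂ n‖ ≤ 1 := by
  rw [truncTensor_eq_starProjection]
  exact Submodule.starProjection_norm_le _

theorem tendsto_truncTensor (z : HTensor H₁ H₂) :
    Tendsto (fun n => truncTensor e₁ e₂ n z) atTop (𝓝 z) := by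
  simp_rw [truncTensor_eq_starProjection]
  refine Submodule.starProjection_tendsto_self (truncRange e₁ e₂) ?_ z (le_of_eq ?_)
  · rintro m n h _ ⟨z, rfl⟩
    exact ⟨truncTensor e₁ e₂ m z, DFunLike.congr_fun (truncTensor_comp e₁ e₂ h) z⟩
  · symm
    rw [Submodule.topologicalClosure_eq_top_iff, Submodule.eq_bot_iff]
    intro w hw
    refine isHilbertTensor_tensorMap.dense w fun x y => ?_
    have h1 : Tendsto (fun n => inner ℂ (tensorMap H₁ H₂ (truncProj e₁ n x) (truncProj e₂ n y)) w)
        atTop (𝓝 (inner ℂ (tensorMap H₁ H₂ x y) w)) := by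
      have hc : Continuous fun p : H₁ × H₂ => tensorMap H₁ H₂ p.1 p.2 := by fun_prop
      exact ((hc.tendsto (x, y)).comp
        ((tendsto_truncProj e₁ x).prodMk_nhds (tendsto_truncProj e₂ y))).inner tendsto_const_nhds
    refine tendsto_nhds_unique h1 (tendsto_const_nhds.congr fun n => ?_)
    rw [← truncTensor_tensorMap]
    exact ((Submodule.mem_orthogonal _ _).1 hw _
      (Submodule.mem_iSup_of_mem n ⟨tensorMap H₁ H₂ x y, rfl⟩)).symm

end Concrete

section Perturbation

variable {K : Type*} [NormedAddCommGroup K] [InnerProductSpace ℂ K]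

theorem norm_sub_le_of_mem (V : Submodule ℂ K) [FiniteDimensional ℂ V] (T : K →L[ℂ] K) {v : K}
    (hv : v ∈ V) : ‖T v - v‖ ≤ (∑ k, ‖T (stdOrthonormalBasis ℂ V k : K) -
      stdOrthonormalBasis ℂ V k‖) * ‖v‖ := by
  have h := starProjection_eq_sum V v
  rw [Submodule.starProjection_eq_self_iff.2 hv] at h
  have h2 : T v - v = ∑ k, inner ℂ (stdOrthonormalBasis ℂ V k : K) v •
      (T (stdOrthonormalBasis ℂ V k : K) - stdOrthonormalBasis ℂ V k) := by
    simp_rw [smul_sub, Finset.sum_sub_distrib, ← h, ← map_smul, ← map_sum, ← h]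
  rw [h2, Finset.sum_mul]
  refine (norm_sum_le _ _).trans (Finset.sum_le_sum fun k _ => ?_)
  rw [norm_smul, mul_comm]
  gcongr
  refine (norm_inner_le_norm _ _).trans (le_of_eq ?_)
  have : ‖(stdOrthonormalBasis ℂ V k : K)‖ = 1 :=
    (stdOrthonormalBasis ℂ V).orthonormal.1 k
  rw [this, one_mul]

/-- If `T` is uniformly close to the identity on `V`, then the projection onto `T V` is almost
dominated by the projection onto `V`. -/
theorem norm_sq_starProjection_map_le (V : Submodule ℂ K) [FiniteDimensional ℂ V] (T : K →L[ℂ] K)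
    {ε : ℝ} (hε : ε < 1) (hT : ∀ v ∈ V, ‖T v - v‖ ≤ ε * ‖v‖) (W : Submodule ℂ K)
    [FiniteDimensional ℂ W] (hW : ∀ w ∈ W, ∃ v ∈ V, T v = w) (h0 : 0 ≤ ε) (x : K) :
    ‖W.starProjection x‖ ^ 2 ≤ ‖V.starProjection x‖ ^ 2 +
      (2 * (ε / (1 - ε)) + (ε / (1 - ε)) ^ 2) * ‖x‖ ^ 2 := by
  set δ := ε / (1 - ε) with hδ
  have hδ0 : 0 ≤ δ := div_nonneg h0 (by linarith)
  set u := W.starProjection x with hu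
  obtain ⟨v, hv, hvu⟩ := hW u (Submodule.starProjection_apply_mem _ _)
  have h1 : ‖v - u‖ ≤ ε * ‖v‖ := by rw [← hvu, norm_sub_rev]; exact hT v hv
  have h2 : ‖v‖ ≤ ‖u‖ + ε * ‖v‖ := by
    calc ‖v‖ = ‖u + (v - u)‖ := by rw [add_sub_cancel]
      _ ≤ _ := (norm_add_le _ _).trans (by gcongr)
  have h3 : ‖v - u‖ ≤ δ * ‖u‖ := by
    refine h1.trans ?_
    rw [hδ, div_mul_eq_mul_div, le_div_iff₀ (by linarith)]
    nlinarith
  have h4 : ‖u‖ ^ 2 = (inner ℂ u x).re := by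
    have := Submodule.re_inner_starProjection_eq_normSq W x
    exact this.symm
  have h5 : inner ℂ u x = inner ℂ u (V.starProjection x) + inner ℂ (u - v) (x - V.starProjection x)
      := by
    have : inner ℂ v (x - V.starProjection x) = 0 :=
      Submodule.inner_right_of_mem_orthogonal hv (Submodule.sub_starProjection_mem_orthogonal _)
    rw [inner_sub_left, this, sub_zero, inner_sub_right]
    ring
  have h6 : ‖x - V.starProjection x‖ ≤ ‖x‖ := by
    have := Submodule.norm_sq_eq_add_norm_sq_starProjection x V
    have h7 : x - V.starProjection x = Vᗮ.starProjection x := by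
      rw [sub_eq_iff_eq_add', V.starProjection_add_starProjection_orthogonal]
    rw [h7]
    refine (abs_le_of_sq_le_sq' ?_ (norm_nonneg _)).2
    rw [this]
    nlinarith [sq_nonneg ‖V.starProjection x‖]
  have h8 : ‖u‖ ^ 2 ≤ ‖u‖ * ‖V.starProjection x‖ + δ * ‖u‖ * ‖x‖ := by
    rw [h4, h5, Complex.add_re]
    refine add_le_add (re_inner_le_norm (𝕜 := ℂ) _ _) ((re_inner_le_norm (𝕜 := ℂ) _ _).trans ?_)
    rw [norm_sub_rev]
    gcongr
  have h9 : ‖u‖ ≤ ‖V.starProjection x‖ + δ * ‖x‖ := by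
    rcases (norm_nonneg u).eq_or_lt with h | h
    · rw [← h]; positivity
    · nlinarith
  have h10 := Submodule.norm_starProjection_apply_le V x
  calc ‖u‖ ^ 2 ≤ (‖V.starProjection x‖ + δ * ‖x‖) ^ 2 := by gcongr
    _ = ‖V.starProjection x‖ ^ 2 + 2 * δ * ‖V.starProjection x‖ * ‖x‖ + δ ^ 2 * ‖x‖ ^ 2 := by ring
    _ ≤ ‖V.starProjection x‖ ^ 2 + 2 * δ * ‖x‖ * ‖x‖ + δ ^ 2 * ‖x‖ ^ 2 := by gcongr
    _ = _ := by ring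

/-- A closed bounded set of operators living on a fixed finite-dimensional subspace is compact. -/
theorem isCompact_of_compressed [CompleteSpace K] (V : Submodule ℂ K) [FiniteDimensional ℂ V]
    {F : Set (K →L[ℂ] K)} (hF : IsClosed F) {R : ℝ} (hR : ∀ X ∈ F, ‖X‖ ≤ R)
    (hV : ∀ X ∈ F, V.starProjection ∘L X ∘L V.starProjection = X) : IsCompact F := by
  let Φ : (V →L[ℂ] V) → (K →L[ℂ] K) := fun Z => V.subtypeL ∘L Z ∘L V.orthogonalProjectionOnto
  have hΦ : Continuous Φ := by fun_prop
  have : ProperSpace (V →L[ℂ] V) := FiniteDimensional.proper ℂ (V →L[ℂ] V)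
  have hc : IsCompact (Φ ⁻¹' F ∩ Metric.closedBall 0 R) :=
    (isCompact_closedBall 0 R).inter_left (hF.preimage hΦ)
  convert hc.image hΦ
  ext X
  constructor
  · intro hX
    have e : Φ (V.orthogonalProjectionOnto ∘L X ∘L V.subtypeL) = X := hV X hX
    refine ⟨V.orthogonalProjectionOnto ∘L X ∘L V.subtypeL, ⟨by rwa [Set.mem_preimage, e], ?_⟩, e⟩
    refine (dist_zero_right (V.orthogonalProjectionOnto ∘L X ∘L V.subtypeL)).trans_le ?_
    have h1 := V.orthogonalProjectionOnto_norm_le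
    have h2 := V.norm_subtypeL_le
    calc _ ≤ ‖V.orthogonalProjectionOnto‖ * (‖X‖ * ‖V.subtypeL‖) :=
          (ContinuousLinearMap.opNorm_comp_le _ _).trans
            (by gcongr; exact ContinuousLinearMap.opNorm_comp_le _ _)
      _ ≤ 1 * (R * 1) := by
          have := hR X hX
          have := (norm_nonneg X).trans this
          gcongr
      _ = R := by ring
  · rintro ⟨Z, ⟨hZ, -⟩, rfl⟩
    exact hZ

theorem exists_subseq_tendsto_compression [CompleteSpace K] (V : Submodule ℂ K)
    [FiniteDimensional ℂ V] {X : ℕ → K →L[ℂ] K} (hX : ∀ n, ‖X n‖ ≤ 1) :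
    ∃ (ρ : K →L[ℂ] K) (φ : ℕ → ℕ), StrictMono φ ∧
      Tendsto (fun n => V.starProjection ∘L X (φ n) ∘L V.starProjection) atTop (𝓝 ρ) ∧
      V.starProjection ∘L ρ ∘L V.starProjection = ρ := by
  let F : Set (K →L[ℂ] K) := {A | ‖A‖ ≤ 1 ∧ V.starProjection ∘L A ∘L V.starProjection = A}
  have hF : IsCompact F :=
    isCompact_of_compressed V ((isClosed_le continuous_norm continuous_const).inter
      (isClosed_eq (by fun_prop) continuous_id)) (fun A hA => hA.1) fun A hA => hA.2
  have hidem : V.starProjection ∘L V.starProjection = V.starProjection :=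
    V.isIdempotentElem_starProjection
  have hmem : ∀ n, V.starProjection ∘L X n ∘L V.starProjection ∈ F := by
    intro n
    constructor
    · have hn := V.starProjection_norm_le
      calc _ ≤ ‖V.starProjection‖ * (‖X n‖ * ‖V.starProjection‖) :=
            (ContinuousLinearMap.opNorm_comp_le _ _).trans
              (by gcongr; exact ContinuousLinearMap.opNorm_comp_le _ _)
        _ ≤ 1 * (1 * 1) := by
            have := hX n
            gcongr
        _ = 1 := by ring
    · calc _ = (V.starProjection ∘L V.starProjection) ∘L X n ∘L
            (V.starProjection ∘L V.starProjection) := rfl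
        _ = _ := by rw [hidem]
  have : FirstCountableTopology (K →L[ℂ] K) :=
    @UniformSpace.firstCountableTopology _ _ (inferInstanceAs (IsCountablyGenerated _))
  obtain ⟨ρ, hρF, φ, hφ, hlim⟩ := hF.tendsto_subseq hmem
  exact ⟨ρ, φ, hφ, hlim, hρF.2⟩

theorem continuous_subspaceTrace (V : Submodule ℂ K) [FiniteDimensional ℂ V] :
    Continuous (subspaceTrace V) := by
  unfold subspaceTrace
  fun_prop

end Perturbation

section Programs

open scoped ENNReal

variable {H₁ H₂ : Type*} [NormedAddCommGroup H₁] [InnerProductSpace ℂ H₁]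
  [NormedAddCommGroup H₂] [InnerProductSpace ℂ H₂] [CompleteSpace H₁] [CompleteSpace H₂]
  {e₁ : HilbertBasis ℕ ℂ H₁} {e₂ : HilbertBasis ℕ ℂ H₂} {ρ₁ : H₁ →L[ℂ] H₁} {ρ₂ : H₂ →L[ℂ] H₂}
  {n : ℕ} {X : HTensor H₁ H₂ →L[ℂ] HTensor H₁ H₂}

theorem posTrace_ne_top_of_compressed
    (hX : 0 ≤ X) (h : truncTensor e₁ e₂ n ∘L X ∘L truncTensor e₁ e₂ n = X) :
    posTrace (someBasis (HTensor H₁ H₂)) X ≠ ∞ := by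
  rw [← h, truncTensor_eq_starProjection, posTrace_starProjection_conj _ _ hX]
  exact ENNReal.ofReal_ne_top

theorem truncProj_conj_nonneg {H : Type*} [NormedAddCommGroup H] [InnerProductSpace ℂ H]
    [CompleteSpace H] (e : HilbertBasis ℕ ℂ H) (n : ℕ) {ρ : H →L[ℂ] H} (hρ : 0 ≤ ρ) :
    0 ≤ truncProj e n ∘L ρ ∘L truncProj e n :=
  starProjection_conj_nonneg _ hρ

theorem truncTensor_conj_nonneg (hX : 0 ≤ X) :
    0 ≤ truncTensor e₁ e₂ n ∘L X ∘L truncTensor e₁ e₂ n := by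
  rw [truncTensor_eq_starProjection]
  exact starProjection_conj_nonneg _ hX

theorem isFeasible_iff_compressed : IsFeasible e₁ e₂ ρ₁ ρ₂ n X ↔
    0 ≤ X ∧ truncTensor e₁ e₂ n ∘L X ∘L truncTensor e₁ e₂ n = X ∧
    partialTrace₂ X ≤ truncProj e₁ n ∘L ρ₁ ∘L truncProj e₁ n ∧
    partialTrace₁ X ≤ truncProj e₂ n ∘L ρ₂ ∘L truncProj e₂ n := by
  constructor
  · rintro ⟨⟨Y, hY, rfl⟩, h2, h1⟩
    refine ⟨truncTensor_conj_nonneg hY, ?_, h2, h1⟩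
    have h := truncTensor_comp e₁ e₂ (le_refl n)
    calc _ = (truncTensor e₁ e₂ n ∘L truncTensor e₁ e₂ n) ∘L Y ∘L
          (truncTensor e₁ e₂ n ∘L truncTensor e₁ e₂ n) := rfl
      _ = _ := by rw [h]
  · rintro ⟨h0, h, h2, h1⟩
    exact ⟨⟨X, h0, h.symm⟩, h2, h1⟩

/-- Feasibility expressed through finitely many values of the quadratic form at a time. -/
theorem isFeasible_iff_sum_le (hρ₁ : 0 ≤ ρ₁) (hρ₂ : 0 ≤ ρ₂) : IsFeasible e₁ e₂ ρ₁ ρ₂ n X ↔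
    0 ≤ X ∧ truncTensor e₁ e₂ n ∘L X ∘L truncTensor e₁ e₂ n = X ∧
    (∀ (x : H₁) (J : Finset (basisSet H₂)),
      ∑ j ∈ J, (inner ℂ (tensorMap H₁ H₂ x (someBasis H₂ j))
        (X (tensorMap H₁ H₂ x (someBasis H₂ j)))).re ≤
      (inner ℂ x ((truncProj e₁ n ∘L ρ₁ ∘L truncProj e₁ n) x)).re) ∧
    (∀ (y : H₂) (J : Finset (basisSet H₁)),
      ∑ j ∈ J, (inner ℂ (tensorMap H₁ H₂ (someBasis H₁ j) y)
        (X (tensorMap H₁ H₂ (someBasis H₁ j) y))).re ≤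
      (inner ℂ y ((truncProj e₂ n ∘L ρ₂ ∘L truncProj e₂ n) y)).re) := by
  rw [isFeasible_iff_compressed]
  refine and_congr_right fun h0 => and_congr_right fun h => ?_
  have hf := posTrace_ne_top_of_compressed h0 h
  rw [partialTrace₂_eq_partialTr, partialTrace₁_eq_partialTr,
    partialTr_le_iff isHilbertTensor_tensorMap _ _ h0 hf
      (truncProj_conj_nonneg e₁ n hρ₁).isSelfAdjoint,
    partialTr_le_iff isHilbertTensor_tensorMap.flip _ _ h0 hf
      (truncProj_conj_nonneg e₂ n hρ₂).isSelfAdjoint]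
  rfl

theorem IsFeasible.nonneg (h : IsFeasible e₁ e₂ ρ₁ ρ₂ n X) : 0 ≤ X :=
  (isFeasible_iff_compressed.1 h).1

theorem IsFeasible.posTrace_le_one (hρ₁ : IsDensityOperator ρ₁)
    (h : IsFeasible e₁ e₂ ρ₁ ρ₂ n X) : posTrace (someBasis (HTensor H₁ H₂)) X ≤ 1 := by
  obtain ⟨h0, hT, h2, -⟩ := isFeasible_iff_compressed.1 h
  obtain ⟨hρ, ht⟩ := isDensityOperator_iff.1 hρ₁
  rw [← ht, ← posTrace_partialTr isHilbertTensor_tensorMap (someBasis H₁) (someBasis H₂) _ h0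
    (posTrace_ne_top_of_compressed h0 hT)]
  refine (posTrace_mono _ h2).trans ?_
  have := posTrace_conj_le (someBasis H₁) (someBasis H₁) hρ (norm_truncProj_le e₁ n)
  rwa [adjoint_truncProj] at this

theorem IsFeasible.norm_le_one (hρ₁ : IsDensityOperator ρ₁)
    (h : IsFeasible e₁ e₂ ρ₁ ρ₂ n X) : ‖X‖ ≤ 1 := by
  have h1 := h.posTrace_le_one hρ₁
  have h2 := norm_le_posTrace _ h.nonneg (ne_top_of_le_ne_top ENNReal.one_ne_top h1)
  exact h2.trans (ENNReal.toReal_mono ENNReal.one_ne_top h1)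

variable (e₁ e₂ n) in
theorem isCompact_setOf_isFeasible (hρ₁ : IsDensityOperator ρ₁) (hρ₂ : IsDensityOperator ρ₂) :
    IsCompact {X | IsFeasible e₁ e₂ ρ₁ ρ₂ n X} := by
  refine isCompact_of_compressed (truncRange e₁ e₂ n) (R := 1) ?_
    (fun X hX => hX.norm_le_one hρ₁) (fun X hX => ?_)
  · simp_rw [isFeasible_iff_sum_le hρ₁.nonneg hρ₂.nonneg, Set.ofPred_and, Set.ofPred_forall]
    refine isClosed_Ici.inter ((isClosed_eq (by fun_prop) continuous_id).inter (.inter ?_ ?_))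
    · exact isClosed_iInter fun x => isClosed_iInter fun J =>
        isClosed_le (by fun_prop) continuous_const
    · exact isClosed_iInter fun x => isClosed_iInter fun J =>
        isClosed_le (by fun_prop) continuous_const
  · rw [← truncTensor_eq_starProjection]
    exact (isFeasible_iff_compressed.1 hX).2.1

variable (e₁ e₂ n) in
theorem isFeasible_zero (hρ₁ : 0 ≤ ρ₁) (hρ₂ : 0 ≤ ρ₂) : IsFeasible e₁ e₂ ρ₁ ρ₂ n 0 := by
  rw [isFeasible_iff_sum_le hρ₁ hρ₂]
  refine ⟨le_rfl, by simp, fun x J => ?_, fun x J => ?_⟩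
  · simpa using re_inner_nonneg (truncProj_conj_nonneg e₁ n hρ₁) x
  · simpa using re_inner_nonneg (truncProj_conj_nonneg e₂ n hρ₂) x

variable (𝒳 : Submodule ℂ (HTensor H₁ H₂)) [FiniteDimensional ℂ 𝒳]

variable (e₁ e₂ ρ₁ ρ₂ n) in
theorem sdpValues_eq_image : sdpValues e₁ e₂ ρ₁ ρ₂ 𝒳 n =
    subspaceTrace (truncSubspace e₁ e₂ 𝒳 n) '' {X | IsFeasible e₁ e₂ ρ₁ ρ₂ n X} := by
  ext t
  refine exists_congr fun X => and_congr_right fun hX => ?_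
  rw [trace_comp_starProjection _ hX.nonneg, Complex.ofReal_inj, eq_comm]

variable (e₁ e₂ n) in
theorem isGreatest_sdpMax (hρ₁ : IsDensityOperator ρ₁) (hρ₂ : IsDensityOperator ρ₂) :
    IsGreatest (sdpValues e₁ e₂ ρ₁ ρ₂ 𝒳 n) (sdpMax e₁ e₂ ρ₁ ρ₂ 𝒳 n) := by
  rw [sdpMax, sdpValues_eq_image]
  exact ((isCompact_setOf_isFeasible e₁ e₂ n hρ₁ hρ₂).image (continuous_subspaceTrace _)).isGreatest_sSup
    ⟨_, _, isFeasible_zero e₁ e₂ n hρ₁.nonneg hρ₂.nonneg, rfl⟩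

theorem IsFeasible.subspaceTrace_le_one (hρ₁ : IsDensityOperator ρ₁)
    (h : IsFeasible e₁ e₂ ρ₁ ρ₂ n X) (V : Submodule ℂ (HTensor H₁ H₂)) [FiniteDimensional ℂ V] :
    subspaceTrace V X ≤ 1 := by
  have := (subspaceTrace_le_posTrace _ V h.nonneg).trans (h.posTrace_le_one hρ₁)
  rwa [← ENNReal.ofReal_one, ENNReal.ofReal_le_ofReal_iff zero_le_one] at this

/-- Truncations of a coupling supported in `𝒳` are feasible and their values tend to one. -/
theorem tendsto_sdpMax_of_exists (hρ₁ : IsDensityOperator ρ₁) (hρ₂ : IsDensityOperator ρ₂)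
    {ρ : HTensor H₁ H₂ →L[ℂ] HTensor H₁ H₂} (hρ : IsDensityOperator ρ)
    (h1 : partialTrace₁ ρ = ρ₂) (h2 : partialTrace₂ ρ = ρ₁) (hs : supp ρ ≤ 𝒳) :
    Tendsto (fun n => sdpMax e₁ e₂ ρ₁ ρ₂ 𝒳 n) atTop (𝓝 1) := by
  obtain ⟨hρ0, hρt⟩ := isDensityOperator_iff.1 hρ
  have hρf : posTrace (someBasis (HTensor H₁ H₂)) ρ ≠ ∞ := by simp [hρt]
  have hfeas : ∀ n, IsFeasible e₁ e₂ ρ₁ ρ₂ n (truncTensor e₁ e₂ n ∘L ρ ∘L truncTensor e₁ e₂ n) := by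
    refine fun n => ⟨⟨ρ, hρ0, rfl⟩, ?_, ?_⟩
    · rw [← h2]
      exact partialTr_conj_le isHilbertTensor_tensorMap _ _ hρ0 hρf (adjoint_truncTensor _ _ _)
        (norm_truncTensor_le _ _ _) (adjoint_truncProj _ _) (norm_truncProj_le _ _)
        (truncTensor_tensorMap _ _ _)
    · rw [← h1]
      exact partialTr_conj_le isHilbertTensor_tensorMap.flip _ _ hρ0 hρf
        (adjoint_truncTensor _ _ _)
        (norm_truncTensor_le _ _ _) (adjoint_truncProj _ _) (norm_truncProj_le _ _)
        (fun y x => truncTensor_tensorMap _ _ _ x y)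
  have hval : ∀ n, subspaceTrace (truncSubspace e₁ e₂ 𝒳 n)
      (truncTensor e₁ e₂ n ∘L ρ ∘L truncTensor e₁ e₂ n) = (posTrace (someBasis (HTensor H₁ H₂))
        (truncTensor e₁ e₂ n ∘L ρ ∘L truncTensor e₁ e₂ n)).toReal := by
    intro n
    rw [← subspaceTrace_eq_posTrace _ (truncSubspace e₁ e₂ 𝒳 n) (hfeas n).nonneg,
      ENNReal.toReal_ofReal (subspaceTrace_nonneg _ (hfeas n).nonneg)]
    exact fun z => ⟨ρ (truncTensor e₁ e₂ n z),
      hs (Submodule.le_topologicalClosure _ ⟨_, rfl⟩), rfl⟩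
  have hlim := tendsto_posTrace_conj (someBasis (HTensor H₁ H₂)) (adjoint_truncTensor e₁ e₂)
    (norm_truncTensor_le e₁ e₂) (tendsto_truncTensor e₁ e₂) hρ0 hρf
  rw [hρt, ENNReal.toReal_one] at hlim
  refine tendsto_of_tendsto_of_tendsto_of_le_of_le hlim tendsto_const_nhds (fun n => ?_) fun n => ?_
  · rw [← hval]
    refine (isGreatest_sdpMax e₁ e₂ n 𝒳 hρ₁ hρ₂).2 ?_
    rw [sdpValues_eq_image]
    exact ⟨_, hfeas n, rfl⟩
  · have h := (isGreatest_sdpMax e₁ e₂ n 𝒳 hρ₁ hρ₂).1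
    rw [sdpValues_eq_image] at h
    obtain ⟨X, hX, h⟩ := h
    exact h ▸ hX.subspaceTrace_le_one hρ₁ _

/-- If almost all of the trace of feasible `X n` lies in `𝒳ₙ`, the same holds for `𝒳`. -/
theorem tendsto_subspaceTrace {X : ℕ → HTensor H₁ H₂ →L[ℂ] HTensor H₁ H₂}
    (hρ₁ : IsDensityOperator ρ₁) (hX : ∀ n, IsFeasible e₁ e₂ ρ₁ ρ₂ n (X n))
    (h : Tendsto (fun n => subspaceTrace (truncSubspace e₁ e₂ 𝒳 n) (X n)) atTop (𝓝 1)) :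
    Tendsto (fun n => subspaceTrace 𝒳 (X n)) atTop (𝓝 1) := by
  let ε : ℕ → ℝ := fun n => ∑ k, ‖truncTensor e₁ e₂ n (stdOrthonormalBasis ℂ 𝒳 k : HTensor H₁ H₂) -
      stdOrthonormalBasis ℂ 𝒳 k‖
  have hε0 : ∀ n, 0 ≤ ε n := fun n => Finset.sum_nonneg fun _ _ => norm_nonneg _
  have hε : Tendsto ε atTop (𝓝 0) := by
    have : Tendsto ε atTop (𝓝 (∑ k, ‖(stdOrthonormalBasis ℂ 𝒳 k : HTensor H₁ H₂) -
      stdOrthonormalBasis ℂ 𝒳 k‖)) :=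
      tendsto_finsetSum _ fun k _ => ((tendsto_truncTensor e₁ e₂ _).sub tendsto_const_nhds).norm
    simpa using this
  have hδ : Tendsto (fun n => ε n / (1 - ε n)) atTop (𝓝 0) := by
    have := hε.div (tendsto_const_nhds.sub hε) (by simp : (1 : ℝ) - 0 ≠ 0)
    rwa [zero_div] at this
  have hc : Tendsto (fun n => 2 * (ε n / (1 - ε n)) + (ε n / (1 - ε n)) ^ 2) atTop (𝓝 0) := by
    simpa using (hδ.const_mul 2).add (hδ.pow 2)
  refine tendsto_of_tendsto_of_tendsto_of_le_of_le' (by simpa using h.sub hc) tendsto_const_nhds ?_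
    (Eventually.of_forall fun n => (hX n).subspaceTrace_le_one hρ₁ _)
  filter_upwards [hε.eventually_lt_const one_pos] with n hn
  have hδ0 : 0 ≤ ε n / (1 - ε n) := div_nonneg (hε0 n) (by linarith)
  have h1 := (hX n).posTrace_le_one hρ₁
  have h2 := subspaceTrace_le_add (someBasis _) (truncSubspace e₁ e₂ 𝒳 n) 𝒳
    (c := 2 * (ε n / (1 - ε n)) + (ε n / (1 - ε n)) ^ 2) (by positivity)
    (norm_sq_starProjection_map_le 𝒳 (truncTensor e₁ e₂ n) hn
      (fun v hv => norm_sub_le_of_mem 𝒳 _ hv) _ (fun w hw => hw) (hε0 n)) (hX n).nonneg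
    (ne_top_of_le_ne_top ENNReal.one_ne_top h1)
  have h3 : (posTrace (someBasis _) (X n)).toReal ≤ 1 := ENNReal.toReal_mono ENNReal.one_ne_top h1
  have h4 := mul_le_mul_of_nonneg_left h3
    (by positivity : 0 ≤ 2 * (ε n / (1 - ε n)) + (ε n / (1 - ε n)) ^ 2)
  linarith

/-- A positive operator whose slices are bounded by a density operator and whose trace is one
has that density operator as partial trace. -/
theorem partialTr_eq_of_sum_le {H G K κ : Type*} [NormedAddCommGroup H] [InnerProductSpace ℂ H]
    [NormedAddCommGroup G] [InnerProductSpace ℂ G] [NormedAddCommGroup K] [InnerProductSpace ℂ K]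
    [CompleteSpace H] [CompleteSpace K] {L : H →L[ℂ] G →L[ℂ] K}
    (hL : IsHilbertTensor L) (c : HilbertBasis κ ℂ G) {ρ : K →L[ℂ] K} (hρ : IsDensityOperator ρ)
    {R : H →L[ℂ] H} (hR : IsDensityOperator R) (h : ∀ (x : H) (J : Finset κ),
      ∑ j ∈ J, (inner ℂ (L x (c j)) (ρ (L x (c j)))).re ≤ (inner ℂ x (R x)).re) :
    partialTr L c ρ = R := by
  obtain ⟨hρ0, hρt⟩ := isDensityOperator_iff.1 hρ
  obtain ⟨hR0, hRt⟩ := isDensityOperator_iff.1 hR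
  have hρf : posTrace (someBasis K) ρ ≠ ∞ := by simp [hρt]
  have ht := posTrace_partialTr hL (someBasis H) c _ hρ0 hρf
  exact eq_of_le_of_posTrace_le (someBasis H) (partialTr_nonneg hL c _ hρ0 hρf)
    ((partialTr_le_iff hL c _ hρ0 hρf hR0.isSelfAdjoint).2 h) (by rw [ht]; exact hρf)
    (by rw [ht, hρt, hRt])

theorem tendsto_re_inner_truncProj_conj {H : Type*} [NormedAddCommGroup H] [InnerProductSpace ℂ H]
    [CompleteSpace H] (e : HilbertBasis ℕ ℂ H) (ρ : H →L[ℂ] H) (x : H) :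
    Tendsto (fun n => (inner ℂ x ((truncProj e n ∘L ρ ∘L truncProj e n) x)).re) atTop
      (𝓝 (inner ℂ x (ρ x)).re) := by
  have h : ∀ n, inner ℂ x ((truncProj e n ∘L ρ ∘L truncProj e n) x) =
      inner ℂ (truncProj e n x) (ρ (truncProj e n x)) := fun n => by
    simp only [ContinuousLinearMap.comp_apply]
    rw [← ContinuousLinearMap.adjoint_inner_left, adjoint_truncProj]
  simp_rw [h]
  have hx := tendsto_truncProj e x
  exact (Complex.continuous_re.tendsto _).comp (hx.inner ((ρ.continuous.tendsto x).comp hx))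

/-- If `V` asymptotically carries the whole trace of the `X n` and the compressions of `X n` to
`V` converge to `ρ`, then asymptotic upper bounds for the quadratic forms of the `X n` hold
for `ρ`. -/
theorem sum_re_inner_le_of_tendsto {ι κ K : Type*} [NormedAddCommGroup K] [InnerProductSpace ℂ K]
    [CompleteSpace K] (b : HilbertBasis ι ℂ K) (V : Submodule ℂ K) [FiniteDimensional ℂ V]
    {X : ℕ → K →L[ℂ] K} (hX : ∀ n, 0 ≤ X n) (hX1 : ∀ n, posTrace b (X n) ≤ 1)
    (htr : Tendsto (fun n => subspaceTrace V (X n)) atTop (𝓝 1)) {ρ : K →L[ℂ] K}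
    (hlim : Tendsto (fun n => V.starProjection ∘L X n ∘L V.starProjection) atTop (𝓝 ρ))
    (J : Finset κ) (f : κ → K) {r : ℕ → ℝ} {s : ℝ}
    (hr : ∀ n, ∑ j ∈ J, (inner ℂ (f j) (X n (f j))).re ≤ r n) (hs : Tendsto r atTop (𝓝 s)) :
    ∑ j ∈ J, (inner ℂ (f j) (ρ (f j))).re ≤ s := by
  set η : ℕ → ℝ := fun n => √(1 - subspaceTrace V (X n)) with hη
  have hη0 : ∀ n, 0 ≤ η n := fun n => Real.sqrt_nonneg _
  have hηlim : Tendsto η atTop (𝓝 0) := by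
    simpa using ((tendsto_const_nhds (x := (1 : ℝ))).sub htr).sqrt
  have hc : Tendsto (fun n => 2 * η n + η n ^ 2) atTop (𝓝 0) := by
    simpa using (hηlim.const_mul 2).add (hηlim.pow 2)
  have hpt : ∀ n z, (inner ℂ z ((V.starProjection ∘L X n ∘L V.starProjection) z)).re ≤
      (inner ℂ z (X n z)).re + (2 * η n + η n ^ 2) * ‖z‖ ^ 2 := by
    intro n z
    have h1 := sqrt_re_inner_starProjection_le b V (hX n) (hX1 n) z
    have h2 : (inner ℂ z (X n z)).re ≤ ‖z‖ ^ 2 := by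
      have := (re_inner_le_posTrace b (hX n) z).trans (mul_le_mul_left (hX1 n) _)
      rwa [one_mul, enorm_sq_eq_ofReal, ENNReal.ofReal_le_ofReal_iff (by positivity)] at this
    have h3 : √(inner ℂ z (X n z)).re ≤ ‖z‖ := Real.sqrt_le_iff.2 ⟨norm_nonneg _, h2⟩
    have h4 := Real.sq_sqrt (re_inner_nonneg (hX n) z)
    have h5 := Real.sq_sqrt (re_inner_nonneg (hX n) (V.starProjection z))
    simp only [ContinuousLinearMap.comp_apply]
    rw [← Submodule.inner_starProjection_left_eq_right, ← h5]
    calc _ ≤ (√(inner ℂ z (X n z)).re + η n * ‖z‖) ^ 2 := by gcongr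
      _ = √(inner ℂ z (X n z)).re ^ 2 + 2 * η n * ‖z‖ * √(inner ℂ z (X n z)).re
          + η n ^ 2 * ‖z‖ ^ 2 := by ring
      _ ≤ (inner ℂ z (X n z)).re + 2 * η n * ‖z‖ * ‖z‖ + η n ^ 2 * ‖z‖ ^ 2 := by
          rw [h4]
          have := hη0 n
          gcongr
      _ = _ := by ring
  have hL : Tendsto (fun n => ∑ j ∈ J,
      (inner ℂ (f j) ((V.starProjection ∘L X n ∘L V.starProjection) (f j))).re) atTop
      (𝓝 (∑ j ∈ J, (inner ℂ (f j) (ρ (f j))).re)) := by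
    have hcont : Continuous fun A : K →L[ℂ] K => ∑ j ∈ J, (inner ℂ (f j) (A (f j))).re := by
      fun_prop
    exact (hcont.tendsto ρ).comp hlim
  have hR : Tendsto (fun n => r n + (2 * η n + η n ^ 2) * ∑ j ∈ J, ‖f j‖ ^ 2) atTop (𝓝 s) := by
    simpa using hs.add (hc.mul_const _)
  refine le_of_tendsto_of_tendsto' hL hR fun n => ?_
  refine (Finset.sum_le_sum fun j _ => hpt n (f j)).trans ?_
  rw [Finset.sum_add_distrib, ← Finset.mul_sum]
  gcongr
  exact hr n

theorem exists_of_tendsto_sdpMax (hρ₁ : IsDensityOperator ρ₁) (hρ₂ : IsDensityOperator ρ₂)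
    (h : Tendsto (fun n => sdpMax e₁ e₂ ρ₁ ρ₂ 𝒳 n) atTop (𝓝 1)) :
    ∃ ρ : HTensor H₁ H₂ →L[ℂ] HTensor H₁ H₂, IsDensityOperator ρ ∧
      partialTrace₁ ρ = ρ₂ ∧ partialTrace₂ ρ = ρ₁ ∧ supp ρ ≤ 𝒳 := by
  have hex : ∀ n, ∃ X, IsFeasible e₁ e₂ ρ₁ ρ₂ n X ∧
      subspaceTrace (truncSubspace e₁ e₂ 𝒳 n) X = sdpMax e₁ e₂ ρ₁ ρ₂ 𝒳 n := by
    intro n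
    have h := (isGreatest_sdpMax e₁ e₂ n 𝒳 hρ₁ hρ₂).1
    rwa [sdpValues_eq_image] at h
  choose X hX hmax using hex
  have htr := tendsto_subspaceTrace 𝒳 hρ₁ hX (by simpa only [hmax] using h)
  obtain ⟨ρ, φ, hφ, hlim, hρF⟩ :=
    exists_subseq_tendsto_compression 𝒳 fun n => (hX n).norm_le_one hρ₁
  have hρ0 : 0 ≤ ρ := ge_of_tendsto' hlim fun n => starProjection_conj_nonneg 𝒳 (hX (φ n)).nonneg
  have hrange : ∀ z, ρ z ∈ 𝒳 := by
    intro z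
    rw [← hρF]
    exact Submodule.starProjection_apply_mem _ _
  have hρt : subspaceTrace 𝒳 ρ = 1 := by
    refine tendsto_nhds_unique (((continuous_subspaceTrace 𝒳).tendsto ρ).comp hlim)
      ((htr.comp hφ.tendsto_atTop).congr fun n => ?_)
    exact (subspaceTrace_starProjection_conj 𝒳 (X (φ n))).symm
  have hρ : IsDensityOperator ρ := by
    refine isDensityOperator_iff.2 ⟨hρ0, ?_⟩
    rw [← subspaceTrace_eq_posTrace _ 𝒳 hρ0 hrange, hρt, ENNReal.ofReal_one]
  refine ⟨ρ, hρ, ?_, ?_, ?_⟩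
  · refine partialTr_eq_of_sum_le isHilbertTensor_tensorMap.flip _ hρ hρ₂ fun y J => ?_
    refine sum_re_inner_le_of_tendsto (someBasis _) 𝒳 (fun n => (hX (φ n)).nonneg)
      (fun n => (hX (φ n)).posTrace_le_one hρ₁) (htr.comp hφ.tendsto_atTop) hlim J _
      (fun n => ((isFeasible_iff_sum_le hρ₁.nonneg hρ₂.nonneg).1 (hX (φ n))).2.2.2 y J)
      ((tendsto_re_inner_truncProj_conj e₂ ρ₂ y).comp hφ.tendsto_atTop)
  · refine partialTr_eq_of_sum_le isHilbertTensor_tensorMap _ hρ hρ₁ fun x J => ?_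
    refine sum_re_inner_le_of_tendsto (someBasis _) 𝒳 (fun n => (hX (φ n)).nonneg)
      (fun n => (hX (φ n)).posTrace_le_one hρ₁) (htr.comp hφ.tendsto_atTop) hlim J _
      (fun n => ((isFeasible_iff_sum_le hρ₁.nonneg hρ₂.nonneg).1 (hX (φ n))).2.2.1 x J)
      ((tendsto_re_inner_truncProj_conj e₁ ρ₁ x).comp hφ.tendsto_atTop)
  · refine Submodule.topologicalClosure_minimal _ ?_ 𝒳.closed_of_finiteDimensional
    rintro _ ⟨z, rfl⟩
    exact hrange z

end Programs

end QuantumMarginal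

end

theorem theorem4p5 {H₁ H₂ : Type*}
    [NormedAddCommGroup H₁] [InnerProductSpace ℂ H₁] [CompleteSpace H₁]
    [NormedAddCommGroup H₂] [InnerProductSpace ℂ H₂] [CompleteSpace H₂]
    (e₁ : HilbertBasis ℕ ℂ H₁) (e₂ : HilbertBasis ℕ ℂ H₂)
    (𝒳 : Submodule ℂ (QuantumMarginal.HTensor H₁ H₂)) [FiniteDimensional ℂ 𝒳]
    (ρ₁ : H₁ →L[ℂ] H₁) (ρ₂ : H₂ →L[ℂ] H₂)
    (hρ₁ : QuantumMarginal.IsDensityOperator ρ₁) (hρ₂ : QuantumMarginal.IsDensityOperator ρ₂) :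
    -- each maximum is attained
    (∀ n, IsGreatest (QuantumMarginal.sdpValues e₁ e₂ ρ₁ ρ₂ 𝒳 n)
      (QuantumMarginal.sdpMax e₁ e₂ ρ₁ ρ₂ 𝒳 n)) ∧
    ((∃ ρ : QuantumMarginal.HTensor H₁ H₂ →L[ℂ] QuantumMarginal.HTensor H₁ H₂,
        QuantumMarginal.IsDensityOperator ρ ∧
        QuantumMarginal.partialTrace₁ ρ = ρ₂ ∧ QuantumMarginal.partialTrace₂ ρ = ρ₁ ∧
        QuantumMarginal.supp ρ ≤ 𝒳) ↔
      Tendsto (fun n => QuantumMarginal.sdpMax e₁ e₂ ρ₁ ρ₂ 𝒳 n) atTop (𝓝 1)) := by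
  exact ⟨fun n => QuantumMarginal.isGreatest_sdpMax e₁ e₂ n 𝒳 hρ₁ hρ₂,
    fun ⟨_, hρ, h1, h2, hs⟩ => QuantumMarginal.tendsto_sdpMax_of_exists 𝒳 hρ₁ hρ₂ hρ h1 h2 hs,
    QuantumMarginal.exists_of_tendsto_sdpMax 𝒳 hρ₁ hρ₂⟩
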